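/- Combinatorial polytopes are convex polytopes (convex hulls of finite sets, the empty polytope $\varnothing$ included) considered up to isomorphism of their face lattices. The face lattice $L(P)$ consists of all faces of $P$, including $\varnothing$ and $P$ itself, ordered by inclusion; $\dim\varnothing=-1$. For a face $F$ of $P$, the face polytope $P/F$ is the combinatorial polytope whose face lattice is the interval $[F,P]$ of $L(P)$ (such a polytope exists). Let $\mathcal P$ be the free abelian group on the nonempty combinatorial polytopes, a commutative ring under the direct product $\times$, with unit the point, graded by $\deg P=2\dim P$. Let $\mathcal{RP}$ be the free abelian group on all combinatorial polytopes, $\varnothing$ included. It is a commutative ring under the join (the convex hull of copies of the two polytopes placed in skew affine subspaces), with unit $\varnothing$, graded by $\deg P=2(\dim P+1)$, and a Hopf algebra over $\mathbb Z$ with $$\Delta P=\sum_{\varnothing\subseteq F\subseteq P}F\otimes P/F,\qquad \varepsilon(\varnothing)=1,\quad \varepsilon(P)=0 \ \text{ for } P\ne\varnothing .$$ Let $\mathrm{Qsym}$ be the ring of quasi-symmetric functions over $\mathbb Z$ in variables $t_1,t_2,\dots$, with $M_{(j_1,\dots,j_k)}=\sum_{l_1<\dots<l_k}t_{l_1}^{j_1}\cdots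 t_{l_k}^{j_k}$ for a composition $(j_1,\dots,j_k)$ (all $j_i\ge1$; $M_{()}=1$), and let $*$ be its involution $M_{(j_1,\dots,j_k)}\mapsto M_{(j_k,\dots,j_1)}$. Define additive maps by the following formulas, where $P$ is a combinatorial polytope (nonempty, except in the definition of $\mathcal F$). * $\mathcal F:\mathcal{RP}\to \mathrm{Qsym}$, $\mathcal F(P)=\sum M_{(\dim x_1-\dim x_0,\,\dots,\,\dim x_{m}-\dim x_{m-1})}$, the sum over all chains $\varnothing=x_0<x_1<\dots<x_m=P$ in $L(P)$ (so $\mathcal F(\varnothing)=1$), and $\mathcal F^*=*\circ\mathcal F$, extended coefficientwise to a map $\mathcal{RP}[\alpha]\to\mathrm{Qsym}[\alpha]$. * $d_k:\mathcal P\to\mathcal P$, $d_kP=\sum F$, the sum over the nonempty faces $F$ of $P$ of dimension $\dim P-k$ (zero if there are none). * $\Delta_{\mathcal L}:\mathcal P\to\mathcal P\otimes\mathrm{Qsym}$, $\Delta_{\mathcal L}P=\sum_{(j_1,\dots,j_k)}(d_{j_1}\cdots d_{j_k}P)\otimes M_{(j_1,\dots,j_k)}$, the sum over all compositions (only those with $j_1+\dots+j_k\le\dim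 P$ contribute, among them the empty one, which gives $P\otimes 1$). * $l_\alpha:\mathcal P\to\mathcal{RP}[\alpha]$, $l_\alpha P=\sum_{\varnothing\ne F\subseteq P}\alpha^{\dim F}\,P/F$. * $f:\mathcal P\to\mathrm{Qsym}[\alpha]$, for $\dim P=n$, $$f(P)=\alpha^n+\sum_{k\ge1}\ \sum_{0\le a_1<\dots<a_k\le n-1}f_{\{a_1,\dots,a_k\}}(P)\,\alpha^{a_1}M_{(n-a_k,\,a_k-a_{k-1},\,\dots,\,a_2-a_1)},$$ where $f_{\{a_1,\dots,a_k\}}(P)$ is the number of chains $F_1\subset\dots\subset F_k$ of faces of $P$ with $\dim F_i=a_i$. **Proposition.** The formula $$\Delta_{\mathcal{RP}}P=\sum_{\varnothing\neq F\subseteq P}F\otimes P/F$$ defines an additive map $\Delta_{\mathcal{RP}}:\mathcal P\to\mathcal P\otimes\mathcal{RP}$ which makes the ring $\mathcal P$ a graded right Hopf comodule over the Hopf algebra $\mathcal{RP}$. That is: 1. $\Delta_{\mathcal{RP}}$ is coassociative: $(\Delta_{\mathcal{RP}}\otimes\mathrm{id})\circ\Delta_{\mathcal{RP}}=(\mathrm{id}\otimes\Delta)\circ\Delta_{\mathcal{RP}}$;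 2. it is counital: $(\mathrm{id}\otimes\varepsilon)\circ\Delta_{\mathcal{RP}}=\mathrm{id}\otimes1$ as maps $\mathcal P\to\mathcal P\otimes\mathbb Z$; 3. it is a homomorphism of unital rings; 4. it preserves degrees, where $\mathcal P\otimes\mathcal{RP}$ carries the total degree. Moreover, $$(1\otimes\mathcal F)\circ\Delta_{\mathcal{RP}}=\Delta_{\mathcal L},\qquad\text{and}\qquad \mathcal F^*(l_\alpha x)=f(x)\quad\text{for all }x\in\mathcal P.$$ -/

import Mathlib

namespace PolyHopf

open scoped TensorProduct

/-! ### Faces, polytopes, combinatorial equivalence -/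

section Faces

variable {E : Type*} [AddCommGroup E] [Module ℝ E]

/-- `F` is a face of `S`: the subset of `S` where some valid linear inequality `g x ≤ m` is tight.
The empty set (`0 ≤ 1`) and `S` itself (`0 ≤ 0`) are faces. -/
def IsFace (S F : Set E) : Prop :=
  ∃ (g : E →ₗ[ℝ] ℝ) (m : ℝ), (∀ x ∈ S, g x ≤ m) ∧ F = {x ∈ S | g x = m}

/-- The faces of `S`, ordered by inclusion. -/
abbrev FaceLattice (S : Set E) : Type _ := {F : Set E // IsFace S F}

/-- The nonempty faces of `S`, ordered by inclusion. -/
abbrev NeFace (S : Set E) : Type _ := {F : FaceLattice S // F.1.Nonempty}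

lemma isFace_empty (S : Set E) : IsFace S ∅ := ⟨0, 1, by simp, by simp⟩

lemma isFace_self (S : Set E) : IsFace S S := ⟨0, 0, by simp, by simp⟩

instance instBoundedOrderFaceLattice (S : Set E) : BoundedOrder (FaceLattice S) where
  top := ⟨S, isFace_self S⟩
  le_top F := by
    obtain ⟨_, g, m, -, rfl⟩ := F
    exact fun x hx => hx.1
  bot := ⟨∅, isFace_empty S⟩
  bot_le F := Set.empty_subset _

lemma IsFace.subset {S F : Set E} (h : IsFace S F) : F ⊆ S := by
  obtain ⟨g, m, -, rfl⟩ := h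
  exact fun x hx => hx.1

lemma face_convexHull (A : Set E) (g : E →ₗ[ℝ] ℝ) (m : ℝ) (h : ∀ x ∈ A, g x ≤ m) :
    {x ∈ convexHull ℝ A | g x = m} = convexHull ℝ {x ∈ A | g x = m} := by
  apply Set.Subset.antisymm
  · have key : convexHull ℝ A ⊆ {x | g x ≤ m ∧ (g x = m → x ∈ convexHull ℝ {x ∈ A | g x = m})} := by
      apply convexHull_min
      · intro x hx
        exact ⟨h x hx, fun hm => subset_convexHull _ _ ⟨hx, hm⟩⟩
      · rw [convex_iff_forall_pos]
        rintro x ⟨hx1, hx2⟩ y ⟨hy1, hy2⟩ a b ha hb hab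
        have e : g (a • x + b • y) = a * g x + b * g y := by simp
        have e2 : m = a * m + b * m := by rw [← add_mul, hab, one_mul]
        refine ⟨?_, fun hm => ?_⟩
        · rw [e, e2]
          gcongr
        · have h1 : a * g x ≤ a * m := by gcongr
          have h2 : b * g y ≤ b * m := by gcongr
          rw [e] at hm
          have h3 : g x = m := mul_left_cancel₀ ha.ne' (by linarith)
          have h4 : g y = m := mul_left_cancel₀ hb.ne' (by linarith)
          exact (convex_convexHull ℝ _) (hx2 h3) (hy2 h4) ha.le hb.le hab
    exact fun x hx => (key hx.1).2 hx.2
  · apply convexHull_min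
    · exact fun x hx => ⟨subset_convexHull _ _ hx.1, hx.2⟩
    · exact (convex_convexHull ℝ A).inter (convex_hyperplane (f := g) g.isLinear m)

lemma valid_convexHull {A : Set E} {g : E →ₗ[ℝ] ℝ} {m : ℝ} (h : ∀ x ∈ A, g x ≤ m) :
    ∀ x ∈ convexHull ℝ A, g x ≤ m := fun _ hx =>
  convexHull_min (t := {x | g x ≤ m}) h (convex_halfSpace_le g.isLinear m) hx

lemma IsFace.eq_convexHull {A F : Set E} (h : IsFace (convexHull ℝ A) F) :
    F = convexHull ℝ (F ∩ A) := by
  obtain ⟨g, m, hg, rfl⟩ := h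
  conv_lhs => rw [face_convexHull A g m (fun x hx => hg x (subset_convexHull _ _ hx))]
  congr 1
  ext x
  simp only [Set.mem_ofPred_eq, Set.mem_inter_iff]
  exact ⟨fun h => ⟨⟨subset_convexHull _ _ h.1, h.2⟩, h.1⟩, fun h => ⟨h.2, h.1.2⟩⟩

lemma IsFace.le_iff {A F G : Set E} (hF : IsFace (convexHull ℝ A) F)
    (hG : IsFace (convexHull ℝ A) G) : F ⊆ G ↔ F ∩ A ⊆ G := by
  refine ⟨fun h x hx => h hx.1, fun h => ?_⟩
  rw [hF.eq_convexHull, hG.eq_convexHull]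
  exact convexHull_mono fun x hx => ⟨h hx, hx.2⟩

/-- `S` is a convex polytope (possibly empty): the convex hull of a finite set. -/
def IsPolytope (S : Set E) : Prop := ∃ V : Finset E, S = convexHull ℝ (V : Set E)

lemma IsPolytope.face {S F : Set E} (hS : IsPolytope S) (hF : IsFace S F) : IsPolytope F := by
  classical
  obtain ⟨V, rfl⟩ := hS
  refine ⟨V.filter (· ∈ F), ?_⟩
  rw [hF.eq_convexHull]
  congr 1
  ext x
  simp only [Finset.coe_filter, Set.mem_inter_iff, Set.mem_ofPred_eq, Finset.mem_coe,
    ← hF.eq_convexHull]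
  tauto

lemma IsPolytope.finite_faces {S : Set E} (hS : IsPolytope S) : Finite (FaceLattice S) := by
  obtain ⟨V, rfl⟩ := hS
  have : Finite (Set V) := inferInstance
  refine Finite.of_injective (fun F : FaceLattice (convexHull ℝ (V : Set E)) =>
    {x : V | (x : E) ∈ F.1}) ?_
  intro F G h
  have h' : ∀ x ∈ V, x ∈ F.1 ↔ x ∈ G.1 := fun x hx => by
    have := Set.ext_iff.1 h ⟨x, hx⟩
    simpa using this
  apply Subtype.ext
  apply Set.Subset.antisymm
  · exact (F.2.le_iff G.2).2 fun x hx => (h' x hx.2).1 hx.1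
  · exact (G.2.le_iff F.2).2 fun x hx => (h' x hx.2).2 hx.1

lemma IsFace.of_face_subset {S F G : Set E} (hF : IsFace S F) (hG : IsFace S G) (h : G ⊆ F) :
    IsFace F G := by
  obtain ⟨g, m, hg, rfl⟩ := hG
  refine ⟨g, m, fun x hx => hg x (hF.subset hx), ?_⟩
  ext x
  exact ⟨fun hx => ⟨h hx, hx.2⟩, fun hx => ⟨hF.subset hx.1, hx.2⟩⟩

lemma IsFace.trans {S F G : Set E} (hS : IsPolytope S) (hF : IsFace S F) (hG : IsFace F G) :
    IsFace S G := by
  classical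
  obtain ⟨V, rfl⟩ := hS
  have hFV := hF.eq_convexHull
  obtain ⟨g, m, hg, rfl⟩ := hF
  obtain ⟨h, k, hh, rfl⟩ := hG
  obtain ⟨t, ht⟩ : ∃ t : ℝ, ∀ x ∈ V, (h x - k) / (m - g x) < t := by
    obtain ⟨t, ht⟩ := (V.image fun x => (h x - k) / (m - g x)).bddAbove
    exact ⟨t + 1, fun x hx => (lt_add_one t).trans_le' (ht (by
      simp only [Finset.coe_image]; exact ⟨x, hx, rfl⟩))⟩
  have hgV : ∀ x ∈ V, g x ≤ m := fun x hx => hg x (subset_convexHull _ _ hx)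
  have key : ∀ x ∈ (V : Set E), (t • g + h) x ≤ t * m + k ∧
      ((t • g + h) x = t * m + k ↔ g x = m ∧ h x = k) := by
    intro x hx
    simp only [LinearMap.add_apply, LinearMap.smul_apply, smul_eq_mul]
    rcases (hgV x hx).lt_or_eq with hlt | heq
    · have := (div_lt_iff₀ (sub_pos.2 hlt)).1 (ht x hx)
      refine ⟨by linarith, fun hc => by linarith, fun hc => by linarith [hc.1]⟩
    · have := hh x ⟨subset_convexHull _ _ hx, heq⟩
      rw [heq]
      refine ⟨by linarith, fun hc => ⟨rfl, by linarith⟩, fun hc => by linarith [hc.2]⟩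
  refine ⟨t • g + h, t * m + k, valid_convexHull fun x hx => (key x hx).1, ?_⟩
  rw [face_convexHull _ _ _ fun x hx => (key x hx).1]
  have e1 : {x ∈ (V : Set E) | (t • g + h) x = t * m + k} =
      {x ∈ {x ∈ (V : Set E) | g x = m} | h x = k} := by
    ext x
    constructor
    · rintro ⟨h1, h2⟩
      have := ((key x h1).2).1 h2
      exact ⟨⟨h1, this.1⟩, this.2⟩
    · rintro ⟨⟨h1, h2⟩, h3⟩
      exact ⟨h1, ((key x h1).2).2 ⟨h2, h3⟩⟩
  rw [e1, ← face_convexHull]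
  · rw [← face_convexHull _ _ _ hgV]
  · exact fun x hx => hh x ⟨subset_convexHull _ _ hx.1, hx.2⟩

/-- The face lattice of a face `F` is the interval of faces contained in `F`. -/
noncomputable def faceIso {S : Set E} (hS : IsPolytope S) (F : FaceLattice S) :
    FaceLattice F.1 ≃o Set.Iic F where
  toFun G := ⟨⟨G.1, F.2.trans hS G.2⟩, G.2.subset⟩
  invFun G := ⟨G.1.1, F.2.of_face_subset G.1.2 G.2⟩
  left_inv _ := rfl
  right_inv _ := rfl
  map_rel_iff' := Iff.rfl

/-- Faces are carried along by injective linear changes of coordinates. -/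
noncomputable def FaceLattice.mapIso {E' : Type*} [AddCommGroup E'] [Module ℝ E']
    (e : E ≃ₗ[ℝ] E') (S : Set E) : FaceLattice S ≃o FaceLattice (e '' S) where
  toFun F := ⟨e '' F.1, by
    obtain ⟨_, g, m, hg, rfl⟩ := F
    refine ⟨g ∘ₗ e.symm.toLinearMap, m, ?_, ?_⟩
    · rintro _ ⟨x, hx, rfl⟩
      simpa using hg x hx
    · ext y
      constructor
      · rintro ⟨x, hx, rfl⟩
        exact ⟨⟨x, hx.1, rfl⟩, by simpa using hx.2⟩
      · rintro ⟨⟨x, hx, rfl⟩, h⟩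
        exact ⟨x, ⟨hx, by simpa using h⟩, rfl⟩⟩
  invFun F := ⟨e ⁻¹' F.1, by
    obtain ⟨_, g, m, hg, rfl⟩ := F
    refine ⟨g ∘ₗ e.toLinearMap, m, fun x hx => hg _ ⟨x, hx, rfl⟩, ?_⟩
    ext x
    simp⟩
  left_inv F := Subtype.ext (Set.preimage_image_eq _ e.injective)
  right_inv F := Subtype.ext (Set.image_preimage_eq _ e.surjective)
  map_rel_iff' {F G} := Set.image_subset_image_iff e.injective

end Faces

/-- A convex polytope (possibly empty) in some `ℝ^d`. -/
structure Polytope where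
  /-- dimension of the ambient space -/
  ambient : ℕ
  /-- the underlying point set -/
  carrier : Set (Fin ambient → ℝ)
  isPolytope : IsPolytope carrier

namespace Polytope

/-- The face lattice `L(P)`. -/
abbrev L (P : Polytope) : Type := FaceLattice P.carrier

noncomputable instance instFintypeL (P : Polytope) : Fintype P.L :=
  have := P.isPolytope.finite_faces
  Fintype.ofFinite _

/-- A polytope in any finite-dimensional real vector space, moved to `ℝ^d` by a choice of
linear coordinates. -/
noncomputable def ofSet {E : Type*} [AddCommGroup E] [Module ℝ E] [FiniteDimensional ℝ E]
    (S : Set E) (hS : IsPolytope S) : Polytope where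
  ambient := Module.finrank ℝ E
  carrier := (Module.finBasis ℝ E).equivFun '' S
  isPolytope := by
    classical
    obtain ⟨V, rfl⟩ := hS
    refine ⟨V.image (Module.finBasis ℝ E).equivFun, ?_⟩
    rw [Finset.coe_image]
    exact LinearMap.image_convexHull (Module.finBasis ℝ E).equivFun.toLinearMap _

noncomputable def ofSetIso {E : Type*} [AddCommGroup E] [Module ℝ E] [FiniteDimensional ℝ E]
    (S : Set E) (hS : IsPolytope S) : (ofSet S hS).L ≃o FaceLattice S :=
  (FaceLattice.mapIso (Module.finBasis ℝ E).equivFun S).symm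

/-- A face of a polytope, as a polytope. -/
def face (P : Polytope) (F : P.L) : Polytope := ⟨P.ambient, F.1, P.isPolytope.face F.2⟩

/-- The empty polytope. -/
def empty : Polytope := ⟨0, ∅, ∅, by simp⟩

/-- The point. -/
def point : Polytope := ⟨0, {0}, {0}, by simp⟩

/-- The direct product `P × Q`. -/
noncomputable def prod (P Q : Polytope) : Polytope :=
  ofSet (P.carrier ×ˢ Q.carrier) (by
    obtain ⟨V, hV⟩ := P.isPolytope
    obtain ⟨W, hW⟩ := Q.isPolytope
    exact ⟨V ×ˢ W, by rw [hV, hW, Finset.coe_product, convexHull_prod]⟩)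

/-- The vertex data of the join: `P` and `Q` placed in skew affine subspaces. -/
def joinSet (P Q : Polytope) : Set ((Fin P.ambient → ℝ) × (Fin Q.ambient → ℝ) × ℝ) :=
  (fun x => (x, 0, 0)) '' P.carrier ∪ (fun y => (0, y, 1)) '' Q.carrier

lemma isPolytope_join (P Q : Polytope) : IsPolytope (convexHull ℝ (joinSet P Q)) := by
  classical
  obtain ⟨V, hV⟩ := P.isPolytope
  obtain ⟨W, hW⟩ := Q.isPolytope
  refine ⟨V.image (fun x => (x, 0, 0)) ∪ W.image (fun y => (0, y, 1)), ?_⟩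
  have h1 : (fun x => ((x, 0, 0) : (Fin P.ambient → ℝ) × (Fin Q.ambient → ℝ) × ℝ)) '' P.carrier =
      convexHull ℝ ((fun x => (x, 0, 0)) '' (V : Set (Fin P.ambient → ℝ))) := by
    rw [hV]
    exact LinearMap.image_convexHull
      (LinearMap.inl ℝ (Fin P.ambient → ℝ) ((Fin Q.ambient → ℝ) × ℝ)) _
  have h2 : (fun y => ((0, y, 1) : (Fin P.ambient → ℝ) × (Fin Q.ambient → ℝ) × ℝ)) '' Q.carrier =
      convexHull ℝ ((fun y => (0, y, 1)) '' (W : Set (Fin Q.ambient → ℝ))) := by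
    rw [hW]
    let f : (Fin Q.ambient → ℝ) →ᵃ[ℝ] (Fin P.ambient → ℝ) × (Fin Q.ambient → ℝ) × ℝ :=
      ((LinearMap.inr ℝ (Fin P.ambient → ℝ) ((Fin Q.ambient → ℝ) × ℝ)).comp
        (LinearMap.inl ℝ (Fin Q.ambient → ℝ) ℝ)).toAffineMap +
        AffineMap.const ℝ (Fin Q.ambient → ℝ) (0, 0, 1)
    have hf : (fun y => (0, y, 1)) = (f : (Fin Q.ambient → ℝ) → _) := by
      ext y <;> simp [f]
    rw [hf]
    exact AffineMap.image_convexHull f _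
  rw [joinSet, h1, h2, convexHull_convexHull_union_left, convexHull_convexHull_union_right]
  simp

/-- The join `P ⋇ Q`: the convex hull of copies of `P` and `Q` lying in skew affine subspaces. -/
noncomputable def join (P Q : Polytope) : Polytope :=
  ofSet (convexHull ℝ (joinSet P Q)) (isPolytope_join P Q)

/-- Combinatorial equivalence: the face lattices are isomorphic. -/
instance setoid : Setoid Polytope where
  r P Q := Nonempty (P.L ≃o Q.L)
  iseqv := ⟨fun _ => ⟨OrderIso.refl _⟩, fun ⟨e⟩ => ⟨e.symm⟩, fun ⟨e⟩ ⟨f⟩ => ⟨e.trans f⟩⟩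

end Polytope

end PolyHopf

namespace PolyHopf
open scoped TensorProduct


section Lattices

variable {E : Type*} [AddCommGroup E] [Module ℝ E] {E' : Type*} [AddCommGroup E'] [Module ℝ E']

lemma neFace_iff_not_isBot {S : Set E} (F : FaceLattice S) : F.1.Nonempty ↔ ¬ IsBot F := by
  rw [isBot_iff_eq_bot, Set.nonempty_iff_ne_empty]
  exact not_congr ⟨fun h => Subtype.ext h, fun h => congrArg Subtype.val h⟩

/-- An isomorphism of face lattices restricts to nonempty faces. -/
noncomputable def neIso {S : Set E} {S' : Set E'} (e : FaceLattice S ≃o FaceLattice S') :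
    NeFace S ≃o NeFace S' where
  toEquiv := e.toEquiv.subtypeEquiv fun F => by
    rw [neFace_iff_not_isBot, neFace_iff_not_isBot, isBot_iff_eq_bot, isBot_iff_eq_bot]
    simp
  map_rel_iff' {F G} := e.le_iff_le (x := F.1) (y := G.1)

lemma withBotIso_exists (S : Set E) : Nonempty (WithBot (NeFace S) ≃o FaceLattice S) := by
  refine ⟨RelIso.ofSurjective (OrderEmbedding.ofMapLEIff
    (fun x : WithBot (NeFace S) => x.recBotCoe ⊥ Subtype.val) ?_) ?_⟩
  · intro a b
    induction a using WithBot.recBotCoe with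
    | bot => simp
    | coe a =>
      induction b using WithBot.recBotCoe with
      | bot =>
        simp only [WithBot.recBotCoe_coe, WithBot.recBotCoe_bot, le_bot_iff, WithBot.coe_ne_bot,
          iff_false]
        exact fun h => (neFace_iff_not_isBot _).1 a.2 (isBot_iff_eq_bot.2 h)
      | coe b => simp
  · intro F
    by_cases h : F.1.Nonempty
    · exact ⟨((⟨F, h⟩ : NeFace S) : WithBot (NeFace S)), rfl⟩
    · exact ⟨⊥, (isBot_iff_eq_bot.1 (not_not.1 fun h' => h ((neFace_iff_not_isBot F).2 h'))).symm⟩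

lemma iso_of_neIso {S : Set E} {S' : Set E'} (e : NeFace S ≃o NeFace S') :
    Nonempty (FaceLattice S ≃o FaceLattice S') := by
  obtain ⟨a⟩ := withBotIso_exists S
  obtain ⟨b⟩ := withBotIso_exists S'
  exact ⟨a.symm.trans (e.withBotCongr.trans b)⟩

lemma isFace_prod {S : Set E} {T : Set E'} {F : Set E} {G : Set E'} (hF : IsFace S F)
    (hG : IsFace T G) : IsFace (S ×ˢ T) (F ×ˢ G) := by
  obtain ⟨g, m, hg, rfl⟩ := hF
  obtain ⟨h, k, hh, rfl⟩ := hG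
  refine ⟨g.coprod h, m + k, fun x hx => add_le_add (hg _ hx.1) (hh _ hx.2), ?_⟩
  ext ⟨x, y⟩
  simp only [Set.mem_prod, Set.mem_ofPred_eq, LinearMap.coprod_apply]
  constructor
  · rintro ⟨⟨h1, h2⟩, h3, h4⟩
    exact ⟨⟨h1, h3⟩, by rw [h2, h4]⟩
  · rintro ⟨⟨h1, h3⟩, h5⟩
    have := hg x h1
    have := hh y h3
    exact ⟨⟨h1, by linarith⟩, h3, by linarith⟩

lemma exists_neProdIso (S : Set E) (T : Set E') :
    Nonempty (NeFace S × NeFace T ≃o NeFace (S ×ˢ T)) := by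
  refine ⟨RelIso.ofSurjective (OrderEmbedding.ofMapLEIff
    (fun x : NeFace S × NeFace T =>
      (⟨⟨x.1.1.1 ×ˢ x.2.1.1, isFace_prod x.1.1.2 x.2.1.2⟩, x.1.2.prod x.2.2⟩ :
        NeFace (S ×ˢ T))) ?_) ?_⟩
  · rintro ⟨F, G⟩ ⟨F', G'⟩
    change F.1.1 ×ˢ G.1.1 ⊆ F'.1.1 ×ˢ G'.1.1 ↔ F.1.1 ⊆ F'.1.1 ∧ G.1.1 ⊆ G'.1.1
    rw [Set.prod_subset_prod_iff]
    have h1 := F.2.ne_empty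
    have h2 := G.2.ne_empty
    tauto
  · rintro ⟨⟨K, k, m, hk, rfl⟩, ⟨⟨x0, y0⟩, ⟨hx0, hy0⟩, h0⟩⟩
    have e : ∀ x y, k (x, y) = k (x, 0) + k (0, y) := fun x y => by
      rw [← map_add]; simp
    have hx : ∀ x ∈ S, k (x, 0) ≤ k (x0, 0) := fun x hx => by
      have := hk (x, y0) ⟨hx, hy0⟩
      rw [e] at this h0
      linarith
    have hy : ∀ y ∈ T, k (0, y) ≤ k (0, y0) := fun y hy => by
      have := hk (x0, y) ⟨hx0, hy⟩
      rw [e] at this h0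
      linarith
    refine ⟨(⟨⟨{x ∈ S | k (x, 0) = k (x0, 0)}, k ∘ₗ LinearMap.inl ℝ E E', k (x0, 0), hx, rfl⟩,
      ⟨x0, hx0, rfl⟩⟩, ⟨⟨{y ∈ T | k (0, y) = k (0, y0)}, k ∘ₗ LinearMap.inr ℝ E E', k (0, y0), hy,
      rfl⟩, ⟨y0, hy0, rfl⟩⟩), ?_⟩
    apply Subtype.ext
    apply Subtype.ext
    ext ⟨x, y⟩
    simp only [OrderEmbedding.coe_ofMapLEIff, Set.mem_prod, Set.mem_ofPred_eq]
    rw [e] at h0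
    rw [e x y]
    constructor
    · rintro ⟨⟨h1, h2⟩, h3, h4⟩
      exact ⟨⟨h1, h3⟩, by rw [h2, h4, h0]⟩
    · rintro ⟨⟨h1, h3⟩, h5⟩
      have := hx x h1
      have := hy y h3
      exact ⟨⟨h1, by linarith⟩, h3, by linarith⟩

end Lattices

namespace Polytope

lemma exists_prodIso (P Q : Polytope) :
    Nonempty (NeFace (P.prod Q).carrier ≃o NeFace P.carrier × NeFace Q.carrier) := by
  obtain ⟨e⟩ := exists_neProdIso P.carrier Q.carrier
  exact ⟨(neIso (ofSetIso _ _)).trans e.symm⟩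

lemma exists_joinIso (P Q : Polytope) : Nonempty ((P.join Q).L ≃o P.L × Q.L) := by
  let i : (Fin P.ambient → ℝ) → (Fin P.ambient → ℝ) × (Fin Q.ambient → ℝ) × ℝ :=
    fun x => (x, 0, 0)
  let j : (Fin Q.ambient → ℝ) → (Fin P.ambient → ℝ) × (Fin Q.ambient → ℝ) × ℝ :=
    fun y => (0, y, 1)
  have hi : ∀ x ∈ P.carrier, i x ∈ joinSet P Q := fun x hx => Or.inl ⟨x, hx, rfl⟩
  have hj : ∀ y ∈ Q.carrier, j y ∈ joinSet P Q := fun y hy => Or.inr ⟨y, hy, rfl⟩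
  have hi' : ∀ x ∈ P.carrier, i x ∈ convexHull ℝ (joinSet P Q) :=
    fun x hx => subset_convexHull _ _ (hi x hx)
  have hj' : ∀ y ∈ Q.carrier, j y ∈ convexHull ℝ (joinSet P Q) :=
    fun y hy => subset_convexHull _ _ (hj y hy)
  have faceI : ∀ F : FaceLattice (convexHull ℝ (joinSet P Q)),
      IsFace P.carrier {x ∈ P.carrier | i x ∈ F.1} := by
    rintro ⟨_, k, m, hk, rfl⟩
    refine ⟨k ∘ₗ LinearMap.inl ℝ _ _, m, fun x hx => hk _ (hi' x hx), ?_⟩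
    ext x
    exact ⟨fun h => ⟨h.1, h.2.2⟩, fun h => ⟨h.1, hi' x h.1, h.2⟩⟩
  have faceJ : ∀ F : FaceLattice (convexHull ℝ (joinSet P Q)),
      IsFace Q.carrier {y ∈ Q.carrier | j y ∈ F.1} := by
    rintro ⟨_, k, m, hk, rfl⟩
    have e : ∀ y, k (j y) = k (0, y, 0) + k (0, 0, 1) := fun y => by
      rw [← map_add]; simp [j]
    refine ⟨k ∘ₗ LinearMap.inr ℝ _ _ ∘ₗ LinearMap.inl ℝ _ _, m - k (0, 0, 1), fun y hy => ?_, ?_⟩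
    · have := hk _ (hj' y hy)
      rw [e] at this
      change k (0, y, 0) ≤ _
      linarith
    · ext y
      change _ ↔ y ∈ Q.carrier ∧ k (0, y, 0) = _
      rw [eq_sub_iff_add_eq, ← e]
      exact ⟨fun h => ⟨h.1, h.2.2⟩, fun h => ⟨h.1, hj' y h.1, h.2⟩⟩
  refine ⟨(ofSetIso _ _).trans (RelIso.ofSurjective (OrderEmbedding.ofMapLEIff
    (fun F : FaceLattice (convexHull ℝ (joinSet P Q)) =>
      ((⟨_, faceI F⟩, ⟨_, faceJ F⟩) : P.L × Q.L)) ?_) ?_)⟩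
  · intro F G
    change {x ∈ P.carrier | i x ∈ F.1} ⊆ {x ∈ P.carrier | i x ∈ G.1} ∧
      {y ∈ Q.carrier | j y ∈ F.1} ⊆ {y ∈ Q.carrier | j y ∈ G.1} ↔ F.1 ⊆ G.1
    rw [F.2.le_iff G.2]
    constructor
    · rintro ⟨h1, h2⟩ z ⟨hz, ⟨x, hx, rfl⟩ | ⟨y, hy, rfl⟩⟩
      · exact (h1 ⟨hx, hz⟩).2
      · exact (h2 ⟨hy, hz⟩).2
    · intro h
      exact ⟨fun x hx => ⟨hx.1, h ⟨hx.2, hi x hx.1⟩⟩, fun y hy => ⟨hy.1, h ⟨hy.2, hj y hy.1⟩⟩⟩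
  · rintro ⟨⟨_, g, m, hg, rfl⟩, ⟨_, h, k, hh, rfl⟩⟩
    let l : (Fin P.ambient → ℝ) × (Fin Q.ambient → ℝ) × ℝ →ₗ[ℝ] ℝ :=
      g.coprod (h.coprod (LinearMap.toSpanSingleton ℝ ℝ (m - k)))
    have li : ∀ x, l (i x) = g x := fun x => by simp [l, i]
    have lj : ∀ y, l (j y) = h y + (m - k) := fun y => by simp [l, j]
    have hl : ∀ z ∈ joinSet P Q, l z ≤ m := by
      rintro _ (⟨x, hx, rfl⟩ | ⟨y, hy, rfl⟩)
      · exact (li x).trans_le (hg x hx)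
      · refine (lj y).trans_le ?_
        have := hh y hy
        linarith
    refine ⟨⟨_, l, m, valid_convexHull hl, rfl⟩, ?_⟩
    apply Prod.ext
    · apply Subtype.ext
      ext x
      change (x ∈ P.carrier ∧ i x ∈ convexHull ℝ (joinSet P Q) ∧ l (i x) = m) ↔
        (x ∈ P.carrier ∧ g x = m)
      rw [li]
      exact ⟨fun h => ⟨h.1, h.2.2⟩, fun h => ⟨h.1, hi' x h.1, h.2⟩⟩
    · apply Subtype.ext
      ext y
      change (y ∈ Q.carrier ∧ j y ∈ convexHull ℝ (joinSet P Q) ∧ l (j y) = m) ↔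
        (y ∈ Q.carrier ∧ h y = k)
      rw [lj]
      exact ⟨fun h => ⟨h.1, by linarith [h.2.2]⟩, fun h => ⟨h.1, hj' y h.1, by linarith [h.2]⟩⟩

lemma exists_facePolytope_aux {d : ℕ} {S : Set (Fin d → ℝ)} {V : Finset (Fin d → ℝ)}
    (hV : S = convexHull ℝ (V : Set (Fin d → ℝ))) {F : Set (Fin d → ℝ)} (hF : IsFace S F) :
    ∃ Q : Polytope, Nonempty (Q.L ≃o Set.Ici (⟨F, hF⟩ : FaceLattice S)) := by
  classical
  obtain ⟨g0, m0, hg0, hF0⟩ := id hF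
  have hVS : ∀ x ∈ V, x ∈ S := fun x hx => by rw [hV]; exact subset_convexHull _ _ hx
  -- homogenize, and divide out the span of `F`
  let D : Submodule ℝ ((Fin d → ℝ) × ℝ) := Submodule.span ℝ ((fun x => (x, (1 : ℝ))) '' F)
  let q : (Fin d → ℝ) → ((Fin d → ℝ) × ℝ) ⧸ D := fun x => D.mkQ (x, 1)
  let u : (Fin d → ℝ) → ((Fin d → ℝ) × ℝ) ⧸ D := fun x => (m0 - g0 x)⁻¹ • q x
  let A : Finset (Fin d → ℝ) := V.filter (· ∉ F)
  have hA : ∀ x ∈ A, 0 < m0 - g0 x := fun x hx => by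
    have h1 := Finset.mem_filter.1 hx
    have h2 := hg0 x (hVS x h1.1)
    rcases h2.lt_or_eq with h | h
    · linarith
    · exact absurd (hF0 ▸ ⟨hVS x h1.1, h⟩) h1.2
  -- the functional on the quotient with `q x ↦ h x - k` when this vanishes on `F`
  have lift : ∀ (h : (Fin d → ℝ) →ₗ[ℝ] ℝ) (k : ℝ), (∀ x ∈ F, h x = k) →
      ∃ l : (((Fin d → ℝ) × ℝ) ⧸ D) →ₗ[ℝ] ℝ, ∀ x, l (q x) = h x - k := by
    intro h k hk
    refine ⟨D.liftQ (h.coprod (LinearMap.toSpanSingleton ℝ ℝ (-k))) ?_, fun x => ?_⟩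
    · rw [Submodule.span_le]
      rintro _ ⟨x, hx, rfl⟩
      simp [hk x hx]
    · simp only [q, Submodule.mkQ_apply, Submodule.liftQ_apply]
      simp [sub_eq_add_neg]
  have unlift : ∀ (l : (((Fin d → ℝ) × ℝ) ⧸ D) →ₗ[ℝ] ℝ),
      ∃ (h : (Fin d → ℝ) →ₗ[ℝ] ℝ) (k : ℝ), (∀ x, l (q x) = h x - k) ∧ ∀ x ∈ F, h x = k := by
    intro l
    have e : ∀ x, l (q x) = (l ∘ₗ D.mkQ ∘ₗ LinearMap.inl ℝ _ _) x -
        (-(l (D.mkQ (0, 1)))) := fun x => by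
      simp only [q, LinearMap.comp_apply, LinearMap.inl_apply, sub_neg_eq_add, ← map_add]
      simp
    refine ⟨_, _, e, fun x hx => ?_⟩
    have hq : q x = 0 := by
      simp only [q, Submodule.mkQ_apply, Submodule.Quotient.mk_eq_zero]
      exact Submodule.subset_span ⟨x, hx, rfl⟩
    have := e x
    rw [hq, map_zero] at this
    linarith
  have hu : ∀ x ∈ A, (m0 - g0 x) • u x = q x := fun x hx => smul_inv_smul₀ (hA x hx).ne' _
  let B : Set (((Fin d → ℝ) × ℝ) ⧸ D) := u '' (A : Set _)
  have hB : IsPolytope (convexHull ℝ B) := ⟨A.image u, by rw [Finset.coe_image]⟩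
  refine ⟨ofSet (convexHull ℝ B) hB, ⟨(ofSetIso _ _).trans (RelIso.symm ?_)⟩⟩
  -- faces above `F` to faces of the hull of the `u x`
  have toFace : ∀ G : Set (Fin d → ℝ), IsFace S G → F ⊆ G →
      ∃ K, IsFace (convexHull ℝ B) K ∧ ∀ x ∈ A, u x ∈ K ↔ x ∈ G := by
    rintro _ ⟨h, k, hh, rfl⟩ hFG
    obtain ⟨l, hl⟩ := lift h k fun x hx => (hFG hx).2
    have hl' : ∀ x ∈ A, l (u x) = (m0 - g0 x)⁻¹ * (h x - k) := fun x _ => by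
      simp only [u, map_smul, smul_eq_mul, hl]
    have hlB : ∀ z ∈ B, l z ≤ 0 := by
      rintro _ ⟨x, hx, rfl⟩
      rw [hl' x hx]
      have := hh x (hVS x (Finset.mem_filter.1 hx).1)
      exact mul_nonpos_of_nonneg_of_nonpos (inv_pos.2 (hA x hx)).le (by linarith)
    refine ⟨_, ⟨l, 0, valid_convexHull hlB, rfl⟩, fun x hx => ?_⟩
    change (u x ∈ convexHull ℝ B ∧ l (u x) = 0) ↔ (x ∈ S ∧ h x = k)
    rw [hl' x hx, mul_eq_zero, or_iff_right (inv_pos.2 (hA x hx)).ne', sub_eq_zero]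
    exact ⟨fun h => ⟨hVS x (Finset.mem_filter.1 hx).1, h.2⟩,
      fun h => ⟨subset_convexHull _ _ ⟨x, hx, rfl⟩, h.2⟩⟩
  choose K hK hKu using toFace
  have leS : ∀ G G' : Set (Fin d → ℝ), IsFace S G → IsFace S G' → F ⊆ G → F ⊆ G' →
      (G ⊆ G' ↔ ∀ x ∈ A, x ∈ G → x ∈ G') := by
    intro G G' hG hG' h h'
    subst hV
    rw [hG.le_iff hG']
    constructor
    · exact fun H x hx hxG => H ⟨hxG, (Finset.mem_filter.1 hx).1⟩
    · rintro H x ⟨hxG, hxV⟩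
      by_cases hxF : x ∈ F
      · exact h' hxF
      · exact H x (Finset.mem_filter.2 ⟨hxV, hxF⟩) hxG
  refine RelIso.ofSurjective (OrderEmbedding.ofMapLEIff
    (fun G : Set.Ici (⟨F, hF⟩ : FaceLattice S) =>
      (⟨K G.1.1 G.1.2 G.2, hK _ _ _⟩ : FaceLattice (convexHull ℝ B))) ?_) ?_
  · intro G G'
    change K _ _ _ ⊆ K _ _ _ ↔ G.1.1 ⊆ G'.1.1
    rw [leS _ _ G.1.2 G'.1.2 G.2 G'.2, (hK _ G.1.2 G.2).le_iff (hK _ G'.1.2 G'.2)]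
    constructor
    · intro H x hx hxG
      exact (hKu _ _ _ x hx).1 (H ⟨(hKu _ _ _ x hx).2 hxG, x, hx, rfl⟩)
    · rintro H _ ⟨hz, x, hx, rfl⟩
      exact (hKu _ _ _ x hx).2 (H x hx ((hKu _ _ _ x hx).1 hz))
  · rintro ⟨_, l, m, hl, rfl⟩
    obtain ⟨h, k, hhk, hkF⟩ := unlift l
    -- the functional `h + m g0 ≤ k + m m0`
    have ev : ∀ x ∈ A, (h + m • g0) x - (k + m * m0) = (m0 - g0 x) * (l (u x) - m) := by
      intro x hx
      have h1 : l (q x) = (m0 - g0 x) * l (u x) := by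
        rw [← hu x hx, map_smul, smul_eq_mul]
      rw [hhk] at h1
      simp only [LinearMap.add_apply, LinearMap.smul_apply, smul_eq_mul]
      linear_combination h1
    have evF : ∀ x ∈ F, (h + m • g0) x = k + m * m0 := by
      intro x hx
      have : g0 x = m0 := by rw [hF0] at hx; exact hx.2
      simp [hkF x hx, this]
    have valid : ∀ x ∈ (V : Set (Fin d → ℝ)), (h + m • g0) x ≤ k + m * m0 := by
      intro x hx
      by_cases hxF : x ∈ F
      · exact (evF x hxF).le
      · have hxA : x ∈ A := Finset.mem_filter.2 ⟨hx, hxF⟩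
        have h1 := ev x hxA
        have h2 := hl _ (subset_convexHull _ _ ⟨x, hxA, rfl⟩)
        have h3 := mul_nonpos_of_nonneg_of_nonpos (hA x hxA).le (sub_nonpos.2 h2)
        linarith
    have hG : IsFace S {x ∈ S | (h + m • g0) x = k + m * m0} :=
      ⟨_, _, by rw [hV]; exact valid_convexHull valid, rfl⟩
    have hFG : F ⊆ {x ∈ S | (h + m • g0) x = k + m * m0} :=
      fun x hx => ⟨hF.subset hx, evF x hx⟩
    refine ⟨⟨⟨_, hG⟩, hFG⟩, ?_⟩
    have memiff : ∀ x ∈ A, x ∈ {x ∈ S | (h + m • g0) x = k + m * m0} ↔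
        u x ∈ {z ∈ convexHull ℝ B | l z = m} := by
      intro x hx
      have h1 := ev x hx
      have h2 : (h + m • g0) x = k + m * m0 ↔ l (u x) = m := by
        rw [← sub_eq_zero, h1, mul_eq_zero, or_iff_right (hA x hx).ne', sub_eq_zero]
      exact ⟨fun H => ⟨subset_convexHull _ _ ⟨x, hx, rfl⟩, h2.1 H.2⟩,
        fun H => ⟨hVS x (Finset.mem_filter.1 hx).1, h2.2 H.2⟩⟩
    have hL : IsFace (convexHull ℝ B) {z ∈ convexHull ℝ B | l z = m} := ⟨l, m, hl, rfl⟩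
    apply Subtype.ext
    apply Set.Subset.antisymm
    · refine ((hK _ hG hFG).le_iff hL).2 ?_
      rintro _ ⟨hz, x, hx, rfl⟩
      exact (memiff x hx).1 ((hKu _ hG hFG x hx).1 hz)
    · refine (hL.le_iff (hK _ hG hFG)).2 ?_
      rintro _ ⟨hz, x, hx, rfl⟩
      exact (hKu _ hG hFG x hx).2 ((memiff x hx).2 hz)

/-- For every face `F` of `P` there is a polytope whose face lattice is the interval `[F, P]`. -/
lemma exists_facePolytope (P : Polytope) (F : P.L) :
    ∃ Q : Polytope, Nonempty (Q.L ≃o Set.Ici F) := by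
  obtain ⟨V, hV⟩ := P.isPolytope
  exact exists_facePolytope_aux hV F.2

end Polytope
end PolyHopf

namespace PolyHopf
open scoped TensorProduct

namespace Polytope

/-- The dimension of a nonempty polytope: the dimension of its affine hull. -/
noncomputable def dim (P : Polytope) : ℕ := Module.finrank ℝ (vectorSpan ℝ P.carrier)

open Classical in
/-- The rank `dim P + 1` of a polytope, where `dim ∅ = -1`. -/
noncomputable def rank (P : Polytope) : ℕ := if P.carrier.Nonempty then P.dim + 1 else 0

lemma rank_of_nonempty {P : Polytope} (h : P.carrier.Nonempty) : P.rank = P.dim + 1 := if_pos h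

lemma vectorSpan_le_ker {d : ℕ} {S : Set (Fin d → ℝ)} {h : (Fin d → ℝ) →ₗ[ℝ] ℝ} {k : ℝ}
    (hS : ∀ x ∈ S, h x = k) : vectorSpan ℝ S ≤ LinearMap.ker h := by
  rw [vectorSpan_def, Submodule.span_le]
  rintro _ ⟨x, hx, y, hy, rfl⟩
  simp [hS x hx, hS y hy]

lemma rank_face_lt {P : Polytope} {F : P.L} (hF : F ≠ ⊤) : (P.face F).rank < P.rank := by
  obtain ⟨F, hF'⟩ := F
  have hne : F ≠ P.carrier := fun h => hF (Subtype.ext h)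
  have hsub := hF'.subset
  obtain ⟨w, hw, hwF⟩ := Set.exists_of_ssubset (hsub.ssubset_of_ne hne)
  rw [rank_of_nonempty (P := P) ⟨w, hw⟩]
  by_cases hFn : F.Nonempty
  · rw [rank_of_nonempty (P := P.face ⟨F, hF'⟩) hFn]
    have hfin : FiniteDimensional ℝ (vectorSpan ℝ P.carrier) :=
      FiniteDimensional.finiteDimensional_submodule _
    refine Nat.succ_lt_succ (Submodule.finrank_lt_finrank_of_lt (t := vectorSpan ℝ P.carrier) ?_)
    refine lt_of_le_of_ne (vectorSpan_mono ℝ hsub) fun heq => hwF ?_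
    obtain ⟨g, m, hg, hFe⟩ := hF'
    obtain ⟨f, hf⟩ := hFn
    have h1 : vectorSpan ℝ F ≤ LinearMap.ker g :=
      vectorSpan_le_ker fun x hx => by rw [hFe] at hx; exact hx.2
    have h2 : w -ᵥ f ∈ vectorSpan ℝ P.carrier := vsub_mem_vectorSpan ℝ hw (hsub hf)
    have h3 : g (w -ᵥ f) = 0 := h1 (heq.symm ▸ h2 : w -ᵥ f ∈ vectorSpan ℝ F)
    rw [hFe] at hf ⊢
    refine ⟨hw, ?_⟩
    rw [vsub_eq_sub, map_sub, hf.2] at h3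
    linarith
  · rw [rank, if_neg (by exact hFn)]
    omega

lemma exists_facet {P : Polytope} (hP : P.carrier.Nonempty) :
    ∃ F : P.L, F ≠ ⊤ ∧ P.rank ≤ (P.face F).rank + 1 := by
  classical
  have hbot : (⊥ : P.L) ≠ ⊤ := fun h => hP.ne_empty (congrArg Subtype.val h).symm
  obtain ⟨F, hF, hmax⟩ := Finset.exists_max_image (Finset.univ.filter fun F : P.L => F ≠ ⊤)
    (fun F => (P.face F).rank) ⟨⊥, by simp [hbot]⟩
  have hF := (Finset.mem_filter.1 hF).2
  have hmax : ∀ G : P.L, G ≠ ⊤ → (P.face G).rank ≤ (P.face F).rank :=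
    fun G hG => hmax G (by simp [hG])
  refine ⟨F, hF, not_lt.1 fun hlt => ?_⟩
  obtain ⟨V, hV⟩ := P.isPolytope
  have hVS : ∀ x ∈ V, x ∈ P.carrier := fun x hx => by rw [hV]; exact subset_convexHull _ _ hx
  have constOn : ∀ (h : (Fin P.ambient → ℝ) →ₗ[ℝ] ℝ) (k : ℝ), (∀ x ∈ V, h x = k) →
      ∀ x ∈ P.carrier, h x = k := by
    intro h k hk x hx
    rw [hV] at hx
    exact convexHull_min (t := {x | h x = k}) hk (convex_hyperplane h.isLinear k) hx
  have validOn : ∀ (h : (Fin P.ambient → ℝ) →ₗ[ℝ] ℝ) (k : ℝ), (∀ x ∈ V, h x ≤ k) →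
      ∀ x ∈ P.carrier, h x ≤ k := by
    intro h k hk x hx
    rw [hV] at hx
    exact valid_convexHull hk x hx
  by_cases hFn : F.1.Nonempty
  · obtain ⟨f, hf⟩ := hFn
    obtain ⟨g, m, hg, hFe⟩ := F.2
    rw [rank_of_nonempty (P := P.face F) ⟨f, hf⟩, rank_of_nonempty hP] at hlt
    have hfm : g f = m := by rw [hFe] at hf; exact hf.2
    obtain ⟨w, hwV, hwF⟩ : ∃ w ∈ V, g w ≠ m := by
      by_contra! hcon
      exact hF (Subtype.ext (F.2.subset.antisymm fun x hx => by
        rw [hFe]; exact ⟨hx, constOn g m hcon x hx⟩))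
    set D := vectorSpan ℝ F.1 ⊔ Submodule.span ℝ {w - f} with hD
    have hDlt : Module.finrank ℝ D < Module.finrank ℝ (vectorSpan ℝ P.carrier) := by
      have h1 := Submodule.finrank_add_le_finrank_add_finrank (vectorSpan ℝ F.1)
        (Submodule.span ℝ {w - f})
      have h2 := (finrank_span_le_card (R := ℝ) ({w - f} : Set (Fin P.ambient → ℝ))).trans_eq
        (by simp : _ = 1)
      have h3 : (P.face F).dim = Module.finrank ℝ (vectorSpan ℝ F.1) := rfl
      have h4 : P.dim = Module.finrank ℝ (vectorSpan ℝ P.carrier) := rfl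
      rw [hD]
      omega
    obtain ⟨v, hv, hvD⟩ : ∃ v ∈ vectorSpan ℝ P.carrier, v ∉ D := by
      by_contra! hcon
      exact absurd (Submodule.finrank_mono (fun v hv => hcon v hv)) (not_le.2 hDlt)
    obtain ⟨h, hvne, hDk⟩ := Submodule.exists_le_ker_of_notMem hvD
    have main : ∀ h : (Fin P.ambient → ℝ) →ₗ[ℝ] ℝ, D ≤ LinearMap.ker h →
        (∃ x ∈ V, h f < h x) → False := by
      intro h hDk hx
      have hFk : ∀ x ∈ F.1, h x = h f := fun x hx => by
        have : h (x -ᵥ f) = 0 := hDk (le_sup_left (a := vectorSpan ℝ F.1)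
          (vsub_mem_vectorSpan ℝ hx hf))
        rw [vsub_eq_sub, map_sub] at this
        linarith
      have hwk : h w = h f := by
        have : h (w - f) = 0 := hDk (le_sup_right (a := vectorSpan ℝ F.1)
          (Submodule.mem_span_singleton_self _))
        rw [map_sub] at this
        linarith
      obtain ⟨y, hy, hmin⟩ := Finset.exists_min_image (V.filter fun x => h f < h x)
        (fun x => (m - g x) / (h x - h f)) (by
          obtain ⟨x, hx, hx'⟩ := hx
          exact ⟨x, Finset.mem_filter.2 ⟨hx, hx'⟩⟩)
      obtain ⟨hyV, hyh⟩ := Finset.mem_filter.1 hy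
      set t := (m - g y) / (h y - h f) with ht
      have ht0 : 0 ≤ t := div_nonneg (sub_nonneg.2 (hg y (hVS y hyV))) (sub_pos.2 hyh).le
      have hty : t * (h y - h f) = m - g y := div_mul_cancel₀ _ (sub_pos.2 hyh).ne'
      have hval : ∀ x ∈ V, (g + t • h) x ≤ m + t * h f := by
        intro x hxV
        simp only [LinearMap.add_apply, LinearMap.smul_apply, smul_eq_mul]
        have h1 := hg x (hVS x hxV)
        rcases le_or_gt (h x) (h f) with hle | hgt
        · have := mul_le_mul_of_nonneg_left hle ht0
          linarith
        · have := hmin x (Finset.mem_filter.2 ⟨hxV, hgt⟩)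
          rw [le_div_iff₀ (sub_pos.2 hgt)] at this
          linarith
      let G : P.L := ⟨{x ∈ P.carrier | (g + t • h) x = m + t * h f}, _, _,
        validOn _ _ hval, rfl⟩
      have hFG : F.1 ⊆ G.1 := fun x hx => ⟨F.2.subset hx, by
        have h1 : g x = m := by rw [hFe] at hx; exact hx.2
        simp [h1, hFk x hx]⟩
      have hyG : y ∈ G.1 := ⟨hVS y hyV, by
        simp only [LinearMap.add_apply, LinearMap.smul_apply, smul_eq_mul]; linarith⟩
      have hyF : y ∉ F.1 := fun hc => absurd (hFk y hc) hyh.ne'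
      have hGtop : G ≠ ⊤ := fun hc => hwF (by
        have : w ∈ G.1 := by rw [hc]; exact hVS w hwV
        have h2 := this.2
        simp only [LinearMap.add_apply, LinearMap.smul_apply, smul_eq_mul, hwk] at h2
        linarith)
      have h1 := hmax G hGtop
      have h2 : ((P.face G).face ⟨F.1, G.2.of_face_subset F.2 hFG⟩).rank < (P.face G).rank :=
        rank_face_lt fun hc => hyF (by
          have : F.1 = G.1 := congrArg (fun z : (P.face G).L => z.1) hc
          rw [this]; exact hyG)
      exact absurd h1 (not_le.2 h2)
    obtain ⟨x, hxV, hxne⟩ : ∃ x ∈ V, h x ≠ h f := by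
      by_contra! hcon
      exact hvne (vectorSpan_le_ker (constOn h (h f) hcon) hv)
    rcases hxne.lt_or_gt with hlt' | hgt'
    · exact main (-h) (fun z hz => by have := hDk hz; simpa using this) ⟨x, hxV, by simpa using hlt'⟩
    · exact main h hDk ⟨x, hxV, hgt'⟩
  · rw [rank, if_neg (by exact hFn), rank_of_nonempty hP] at hlt
    have hdim : Module.finrank ℝ (vectorSpan ℝ P.carrier) ≠ 0 := by
      change P.dim ≠ 0
      omega
    obtain ⟨x, hx, y, hy, hxy⟩ : P.carrier.Nontrivial := by
      rw [← Set.not_subsingleton_iff]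
      intro hs
      rw [vectorSpan_of_subsingleton ℝ hs, finrank_bot] at hdim
      exact hdim rfl
    obtain ⟨i, hi⟩ := Function.ne_iff.1 hxy
    let g : (Fin P.ambient → ℝ) →ₗ[ℝ] ℝ := LinearMap.proj i
    have hVn : V.Nonempty := by
      rw [Finset.nonempty_iff_ne_empty]
      rintro rfl
      rw [hV] at hx
      simp at hx
    obtain ⟨z, hz, hzmax⟩ := Finset.exists_max_image V (fun x => g x) hVn
    let G : P.L := ⟨{x ∈ P.carrier | g x = g z}, _, _, validOn _ _ hzmax, rfl⟩
    have hGtop : G ≠ ⊤ := fun hc => hi (by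
      have h1 : x ∈ G.1 := by rw [hc]; exact hx
      have h2 : y ∈ G.1 := by rw [hc]; exact hy
      exact h1.2.trans h2.2.symm)
    have h1 := hmax G hGtop
    rw [rank_of_nonempty (P := P.face G) ⟨z, hVS z hz, rfl⟩, rank, if_neg (by exact hFn)] at h1
    omega

end Polytope

section Order

variable {α β : Type*}

def iicIso [Preorder α] [Preorder β] (e : α ≃o β) (a : α) : Set.Iic a ≃o Set.Iic (e a) where
  toEquiv := e.toEquiv.subtypeEquiv fun b => by simp
  map_rel_iff' {x y} := e.le_iff_le (x := x.1) (y := y.1)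

def iciIso [Preorder α] [Preorder β] (e : α ≃o β) (a : α) : Set.Ici a ≃o Set.Ici (e a) where
  toEquiv := e.toEquiv.subtypeEquiv fun b => by simp
  map_rel_iff' {x y} := e.le_iff_le (x := x.1) (y := y.1)

def iicIic [Preorder α] {a : α} (x : Set.Iic a) : Set.Iic x ≃o Set.Iic x.1 where
  toFun y := ⟨y.1.1, y.2⟩
  invFun y := ⟨⟨y.1, le_trans y.2 x.2⟩, y.2⟩
  left_inv _ := rfl
  right_inv _ := rfl
  map_rel_iff' := Iff.rfl

def iciIci [Preorder α] {a : α} (x : Set.Ici a) : Set.Ici x ≃o Set.Ici x.1 where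
  toFun y := ⟨y.1.1, y.2⟩
  invFun y := ⟨⟨y.1, le_trans x.2 y.2⟩, y.2⟩
  left_inv _ := rfl
  right_inv _ := rfl
  map_rel_iff' := Iff.rfl

def iciIic [Preorder α] {a : α} (x : Set.Iic a) : Set.Ici x ≃o Set.Icc x.1 a where
  toFun y := ⟨y.1.1, y.2, y.1.2⟩
  invFun y := ⟨⟨y.1, y.2.2⟩, y.2.1⟩
  left_inv _ := rfl
  right_inv _ := rfl
  map_rel_iff' := Iff.rfl

def iicIci [Preorder α] {a : α} (x : Set.Ici a) : Set.Iic x ≃o Set.Icc a x.1 where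
  toFun y := ⟨y.1.1, y.1.2, y.2⟩
  invFun y := ⟨⟨y.1, y.2.1⟩, y.2.2⟩
  left_inv _ := rfl
  right_inv _ := rfl
  map_rel_iff' := Iff.rfl

def iicProd [Preorder α] [Preorder β] (a : α) (b : β) :
    Set.Iic (a, b) ≃o Set.Iic a × Set.Iic b where
  toFun y := (⟨y.1.1, y.2.1⟩, ⟨y.1.2, y.2.2⟩)
  invFun y := ⟨(y.1.1, y.2.1), y.1.2, y.2.2⟩
  left_inv _ := rfl
  right_inv _ := rfl
  map_rel_iff' := Iff.rfl

def iciProd [Preorder α] [Preorder β] (a : α) (b : β) :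
    Set.Ici (a, b) ≃o Set.Ici a × Set.Ici b where
  toFun y := (⟨y.1.1, y.2.1⟩, ⟨y.1.2, y.2.2⟩)
  invFun y := ⟨(y.1.1, y.2.1), y.1.2, y.2.2⟩
  left_inv _ := rfl
  right_inv _ := rfl
  map_rel_iff' := Iff.rfl

end Order

namespace Polytope

noncomputable def faceIso (P : Polytope) (F : P.L) : (P.face F).L ≃o Set.Iic F :=
  PolyHopf.faceIso P.isPolytope F

lemma face_congr {P Q : Polytope} (e : P.L ≃o Q.L) (F : P.L) : P.face F ≈ Q.face (e F) :=
  ⟨(P.faceIso F).trans ((iicIso e F).trans (Q.faceIso (e F)).symm)⟩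

/-- The face polytope `P / F`, determined up to combinatorial equivalence by the property that
its face lattice is the interval `[F, P]` of the face lattice of `P`. -/
noncomputable def facePolytope (P : Polytope) (F : P.L) : Polytope :=
  (exists_facePolytope P F).choose

noncomputable def facePolytopeIso (P : Polytope) (F : P.L) :
    (P.facePolytope F).L ≃o Set.Ici F :=
  (exists_facePolytope P F).choose_spec.some

lemma facePolytope_congr {P Q : Polytope} (e : P.L ≃o Q.L) (F : P.L) :
    P.facePolytope F ≈ Q.facePolytope (e F) :=
  ⟨(P.facePolytopeIso F).trans ((iciIso e F).trans (Q.facePolytopeIso (e F)).symm)⟩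

lemma nonempty_iff {P : Polytope} : P.carrier.Nonempty ↔ (⊥ : P.L) ≠ ⊤ := by
  rw [Set.nonempty_iff_ne_empty]
  exact not_congr ⟨fun h => Subtype.ext h.symm, fun h => (congrArg Subtype.val h).symm⟩

lemma nonempty_congr {P Q : Polytope} (e : P.L ≃o Q.L) :
    P.carrier.Nonempty ↔ Q.carrier.Nonempty := by
  rw [nonempty_iff, nonempty_iff, ← e.map_bot, ← e.map_top, ne_eq, ne_eq, e.injective.eq_iff]

lemma rank_le_of_iso : ∀ (n : ℕ) (P Q : Polytope), P.rank ≤ n → (P.L ≃o Q.L) →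
    P.rank ≤ Q.rank := by
  intro n
  induction n with
  | zero => intro P Q h _; omega
  | succ n ih =>
    intro P Q h e
    by_cases hP : P.carrier.Nonempty
    · obtain ⟨F, hF, hr⟩ := exists_facet hP
      have h1 := rank_face_lt hF
      have h2 := ih (P.face F) (Q.face (e F)) (by omega) (face_congr e F).some
      have h3 : (Q.face (e F)).rank < Q.rank := rank_face_lt (by simpa using hF)
      omega
    · rw [rank, if_neg hP]
      omega

/-- The rank, hence the dimension, is invariant under combinatorial equivalence. -/
lemma rank_congr {P Q : Polytope} (h : P ≈ Q) : P.rank = Q.rank :=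
  le_antisymm (rank_le_of_iso _ P Q le_rfl h.some) (rank_le_of_iso _ Q P le_rfl h.some.symm)

lemma dim_congr {P Q : Polytope} (h : P ≈ Q) (hP : P.carrier.Nonempty) : P.dim = Q.dim := by
  have := rank_congr h
  rw [rank_of_nonempty hP, rank_of_nonempty ((nonempty_congr h.some).1 hP)] at this
  omega

end Polytope

end PolyHopf

namespace PolyHopf
open scoped TensorProduct

section Order

variable {α β γ δ : Type*}

def prodCongrIso [Preorder α] [Preorder β] [Preorder γ] [Preorder δ] (e : α ≃o γ) (f : β ≃o δ) :
    α × β ≃o γ × δ where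
  toEquiv := e.toEquiv.prodCongr f.toEquiv
  map_rel_iff' {x y} := by
    change e x.1 ≤ e y.1 ∧ f x.2 ≤ f y.2 ↔ x.1 ≤ y.1 ∧ x.2 ≤ y.2
    rw [e.le_iff_le, f.le_iff_le]

def prodUniqueIso (α β : Type*) [Preorder α] [Preorder β] [Unique β] : α × β ≃o α where
  toEquiv := Equiv.prodUnique α β
  map_rel_iff' {x y} := by
    change x.1 ≤ y.1 ↔ x.1 ≤ y.1 ∧ x.2 ≤ y.2
    rw [Subsingleton.elim x.2 y.2]
    simp

end Order

/-- A nonempty convex polytope. -/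
structure NePolytope extends Polytope where
  nonempty : carrier.Nonempty

namespace Polytope

lemma join_congr {P P' Q Q' : Polytope} (h : P ≈ P') (h' : Q ≈ Q') :
    P.join Q ≈ P'.join Q' := by
  obtain ⟨e⟩ := h
  obtain ⟨e'⟩ := h'
  obtain ⟨a⟩ := exists_joinIso P Q
  obtain ⟨b⟩ := exists_joinIso P' Q'
  exact ⟨a.trans ((prodCongrIso e e').trans b.symm)⟩

instance instUniqueEmptyL : Unique empty.L where
  default := ⊥
  uniq F := Subtype.ext (Set.subset_eq_empty F.2.subset rfl)

instance instUniquePoint : Unique (NeFace point.carrier) where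
  default := ⟨⊤, ⟨0, rfl⟩⟩
  uniq F := Subtype.ext (Subtype.ext
    ((Set.subset_singleton_iff_eq.1 F.1.2.subset).resolve_left F.2.ne_empty))

end Polytope

open Polytope

/-- The set of combinatorial polytopes (the empty one included): classes of polytopes up to
isomorphism of face lattices. -/
def CombPolytope : Type := Quotient Polytope.setoid

/-- The combinatorial polytopes form a commutative monoid under the join, with unit `∅`. -/
noncomputable instance instCommMonoidCombPolytope : CommMonoid CombPolytope where
  mul := Quotient.map₂ Polytope.join fun _ _ h _ _ h' => join_congr h h'
  one := Quotient.mk _ Polytope.empty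
  mul_assoc := by
    rintro ⟨P⟩ ⟨Q⟩ ⟨R⟩
    obtain ⟨a⟩ := exists_joinIso P Q
    obtain ⟨b⟩ := exists_joinIso (P.join Q) R
    obtain ⟨c⟩ := exists_joinIso Q R
    obtain ⟨d⟩ := exists_joinIso P (Q.join R)
    exact Quotient.sound ⟨b.trans ((prodCongrIso a (OrderIso.refl _)).trans
      ((OrderIso.prodAssoc _ _ _).trans ((prodCongrIso (OrderIso.refl _) c.symm).trans d.symm)))⟩
  one_mul := by
    rintro ⟨P⟩
    obtain ⟨a⟩ := exists_joinIso empty P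
    exact Quotient.sound ⟨a.trans (OrderIso.prodComm.trans (prodUniqueIso _ _))⟩
  mul_one := by
    rintro ⟨P⟩
    obtain ⟨a⟩ := exists_joinIso P empty
    exact Quotient.sound ⟨a.trans (prodUniqueIso _ _)⟩
  mul_comm := by
    rintro ⟨P⟩ ⟨Q⟩
    obtain ⟨a⟩ := exists_joinIso P Q
    obtain ⟨b⟩ := exists_joinIso Q P
    exact Quotient.sound ⟨a.trans (OrderIso.prodComm.trans b.symm)⟩

namespace NePolytope

/-- Combinatorial equivalence of nonempty polytopes. -/
instance setoid : Setoid NePolytope := Setoid.comap NePolytope.toPolytope Polytope.setoid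

/-- The direct product of nonempty polytopes. -/
noncomputable def prod (P Q : NePolytope) : NePolytope :=
  ⟨P.toPolytope.prod Q.toPolytope, (P.nonempty.prod Q.nonempty).image _⟩

/-- The point. -/
def point : NePolytope := ⟨Polytope.point, ⟨0, rfl⟩⟩

/-- A nonempty face. -/
def face (P : NePolytope) (F : NeFace P.carrier) : NePolytope := ⟨P.toPolytope.face F.1, F.2⟩

/-- The face polytope `P / F` of a nonempty face. -/
noncomputable def facePolytope (P : NePolytope) (F : NeFace P.carrier) : Polytope :=
  P.toPolytope.facePolytope F.1

noncomputable instance instFintypeNeFace (P : NePolytope) : Fintype (NeFace P.carrier) :=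
  have := P.isPolytope.finite_faces
  Fintype.ofFinite _

lemma equiv_of_neIso {P Q : NePolytope} (e : NeFace P.carrier ≃o NeFace Q.carrier) : P ≈ Q :=
  iso_of_neIso e

lemma prod_congr {P P' Q Q' : NePolytope} (h : P ≈ P') (h' : Q ≈ Q') :
    P.prod Q ≈ P'.prod Q' := by
  obtain ⟨e⟩ := h
  obtain ⟨e'⟩ := h'
  obtain ⟨a⟩ := exists_prodIso P.toPolytope Q.toPolytope
  obtain ⟨b⟩ := exists_prodIso P'.toPolytope Q'.toPolytope
  exact equiv_of_neIso (a.trans ((prodCongrIso (neIso e) (neIso e')).trans b.symm))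

lemma face_congr {P Q : NePolytope} (e : P.L ≃o Q.L) (F : NeFace P.carrier) :
    P.face F ≈ Q.face (neIso e F) := Polytope.face_congr e F.1

lemma facePolytope_congr {P Q : NePolytope} (e : P.L ≃o Q.L) (F : NeFace P.carrier) :
    P.facePolytope F ≈ Q.facePolytope (neIso e F) := Polytope.facePolytope_congr e F.1

end NePolytope

/-- The set of nonempty combinatorial polytopes. -/
def NeCombPolytope : Type := Quotient NePolytope.setoid

/-- The nonempty combinatorial polytopes form a commutative monoid under the direct product,
with unit the point. -/
noncomputable instance instCommMonoidNeCombPolytope : CommMonoid NeCombPolytope where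
  mul := Quotient.map₂ NePolytope.prod fun _ _ h _ _ h' => NePolytope.prod_congr h h'
  one := Quotient.mk _ NePolytope.point
  mul_assoc := by
    rintro ⟨P⟩ ⟨Q⟩ ⟨R⟩
    obtain ⟨a⟩ := exists_prodIso P.toPolytope Q.toPolytope
    obtain ⟨b⟩ := exists_prodIso (P.prod Q).toPolytope R.toPolytope
    obtain ⟨c⟩ := exists_prodIso Q.toPolytope R.toPolytope
    obtain ⟨d⟩ := exists_prodIso P.toPolytope (Q.prod R).toPolytope
    exact Quotient.sound (NePolytope.equiv_of_neIso (b.trans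
      ((prodCongrIso a (OrderIso.refl _)).trans ((OrderIso.prodAssoc _ _ _).trans
        ((prodCongrIso (OrderIso.refl _) c.symm).trans d.symm)))))
  one_mul := by
    rintro ⟨P⟩
    obtain ⟨a⟩ := exists_prodIso Polytope.point P.toPolytope
    exact Quotient.sound (NePolytope.equiv_of_neIso
      (a.trans (OrderIso.prodComm.trans (prodUniqueIso _ _))))
  mul_one := by
    rintro ⟨P⟩
    obtain ⟨a⟩ := exists_prodIso P.toPolytope Polytope.point
    exact Quotient.sound (NePolytope.equiv_of_neIso (a.trans (prodUniqueIso _ _)))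
  mul_comm := by
    rintro ⟨P⟩ ⟨Q⟩
    obtain ⟨a⟩ := exists_prodIso P.toPolytope Q.toPolytope
    obtain ⟨b⟩ := exists_prodIso Q.toPolytope P.toPolytope
    exact Quotient.sound (NePolytope.equiv_of_neIso (a.trans (OrderIso.prodComm.trans b.symm)))

/-- Makes instance search use the tensor product module structure over `ℤ`, rather than the
(equal) canonical `ℤ`-module structure of an additive group. -/
instance instModuleIntTensor {M N : Type*} [AddCommMonoid M] [AddCommMonoid N] [Module ℤ M]
    [Module ℤ N] : Module ℤ (M ⊗[ℤ] N) := TensorProduct.instModule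

/-! ### The rings `𝒫` and `ℛ𝒫` -/

/-- The ring of polytopes `𝒫`: the free abelian group on nonempty combinatorial polytopes, with
multiplication induced by the direct product. -/
def PolytopeRing : Type := MonoidAlgebra ℤ NeCombPolytope

noncomputable instance instCommRingPolytopeRing : CommRing PolytopeRing :=
  inferInstanceAs (CommRing (MonoidAlgebra ℤ NeCombPolytope))

/-- The ring `ℛ𝒫`: the free abelian group on all combinatorial polytopes, `∅` included, with
multiplication induced by the join. -/
def RP : Type := MonoidAlgebra ℤ CombPolytope

noncomputable instance instCommRingRP : CommRing RP :=
  inferInstanceAs (CommRing (MonoidAlgebra ℤ CombPolytope))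

namespace PolytopeRing

/-- The basis of `𝒫` formed by the nonempty combinatorial polytopes. -/
noncomputable def basis : Module.Basis NeCombPolytope ℤ PolytopeRing :=
  .ofRepr (MonoidAlgebra.coeffAddEquiv (R := ℤ) (M := NeCombPolytope)).toIntLinearEquiv

/-- The class `[P] ∈ 𝒫` of a polytope. -/
noncomputable def of (P : NePolytope) : PolytopeRing := basis (Quotient.mk _ P)

variable {M : Type*} [AddCommMonoid M] [Module ℤ M]

/-- The linear map on `𝒫` with prescribed values `f P`, where `f` is a combinatorial invariant. -/
noncomputable def lift (f : NePolytope → M) (hf : ∀ P Q, P ≈ Q → f P = f Q) :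
    PolytopeRing →ₗ[ℤ] M :=
  basis.constr ℕ (Quotient.lift f hf)

@[simp] lemma lift_of (f : NePolytope → M) (hf : ∀ P Q, P ≈ Q → f P = f Q) (P : NePolytope) :
    lift f hf (of P) = f P := basis.constr_basis ℕ _ _

lemma of_congr {P Q : NePolytope} (h : P ≈ Q) : of P = of Q :=
  congrArg basis (Quotient.sound h)

end PolytopeRing

namespace RP

/-- The basis of `ℛ𝒫` formed by the combinatorial polytopes. -/
noncomputable def basis : Module.Basis CombPolytope ℤ RP :=
  .ofRepr (MonoidAlgebra.coeffAddEquiv (R := ℤ) (M := CombPolytope)).toIntLinearEquiv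

/-- The class `[P] ∈ ℛ𝒫` of a polytope. -/
noncomputable def of (P : Polytope) : RP := basis (Quotient.mk _ P)

variable {M : Type*} [AddCommMonoid M] [Module ℤ M]

/-- The linear map on `ℛ𝒫` with prescribed values `f P`, where `f` is a combinatorial invariant. -/
noncomputable def lift (f : Polytope → M) (hf : ∀ P Q, P ≈ Q → f P = f Q) : RP →ₗ[ℤ] M :=
  basis.constr ℕ (Quotient.lift f hf)

@[simp] lemma lift_of (f : Polytope → M) (hf : ∀ P Q, P ≈ Q → f P = f Q) (P : Polytope) :
    lift f hf (of P) = f P := basis.constr_basis ℕ _ _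

lemma of_congr {P Q : Polytope} (h : P ≈ Q) : of P = of Q :=
  congrArg basis (Quotient.sound h)

lemma hom_ext {f g : RP →ₗ[ℤ] M} (h : ∀ P, f (of P) = g (of P)) : f = g :=
  basis.ext fun c => by
    induction c using Quotient.inductionOn with
    | h P => exact h P

lemma of_mul (P Q : Polytope) : of P * of Q = of (P.join Q) := by
  have h := MonoidAlgebra.single_mul_single (R := ℤ) (M := CombPolytope) (Quotient.mk _ P)
    (Quotient.mk _ Q) 1 1
  rw [mul_one] at h
  exact h

lemma of_empty : of Polytope.empty = 1 := rfl

lemma of_mul_of {P Q R : Polytope} (e : P.L × Q.L ≃o R.L) : of P * of Q = of R := by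
  rw [of_mul]
  exact of_congr ⟨(exists_joinIso P Q).some.trans e⟩

/-! ### The Hopf algebra `ℛ𝒫` -/

/-- The comultiplication `Δ P = ∑_{∅ ⊆ F ⊆ P} F ⊗ P/F`. -/
noncomputable def comul : RP →ₗ[ℤ] RP ⊗[ℤ] RP :=
  lift (fun P => ∑ F : P.L, of (P.face F) ⊗ₜ[ℤ] of (P.facePolytope F)) fun P Q ⟨e⟩ =>
    Fintype.sum_equiv e.toEquiv _ _ fun F => by
      rw [of_congr (face_congr e F), of_congr (facePolytope_congr e F)]
      rfl

open Classical in
/-- The counit: `ε(∅) = 1` and `ε(P) = 0` for nonempty `P`. -/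
noncomputable def counit : RP →ₗ[ℤ] ℤ :=
  lift (fun P => if P.carrier.Nonempty then 0 else 1) fun P Q ⟨e⟩ => by
    simp only [nonempty_congr e]

lemma comul_of (P : Polytope) :
    comul (of P) = ∑ F : P.L, of (P.face F) ⊗ₜ[ℤ] of (P.facePolytope F) := lift_of _ _ _

open Classical in
lemma counit_of (P : Polytope) : counit (of P) = if P.carrier.Nonempty then 0 else 1 :=
  lift_of _ _ _

lemma face_top_equiv (P : Polytope) : P.face ⊤ ≈ P := Setoid.refl P

lemma facePolytope_bot_equiv (P : Polytope) : P.facePolytope ⊥ ≈ P :=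
  ⟨(P.facePolytopeIso ⊥).trans
    { toFun := Subtype.val, invFun := fun x => ⟨x, (bot_le : ⊥ ≤ x)⟩, left_inv := fun _ => rfl,
      right_inv := fun _ => rfl, map_rel_iff' := Iff.rfl }⟩

lemma facePolytope_nonempty_iff (P : Polytope) (F : P.L) :
    (P.facePolytope F).carrier.Nonempty ↔ F ≠ ⊤ := by
  have e := P.facePolytopeIso F
  have hb : (e ⊥).1 = F := by
    have h := e.le_symm_apply.1 (bot_le (a := e.symm ⟨F, (le_refl F : F ≤ F)⟩))
    exact le_antisymm h (e ⊥).2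
  have ht : (e ⊤).1 = ⊤ := by
    have h := e.symm_apply_le.1 (le_top (a := e.symm ⟨⊤, (le_top : F ≤ ⊤)⟩))
    exact le_antisymm le_top h
  rw [nonempty_iff, ← e.injective.ne_iff, ne_eq, Subtype.ext_iff, hb, ht]

lemma face_nonempty_iff (P : Polytope) (F : P.L) : (P.face F).carrier.Nonempty ↔ F ≠ ⊥ := by
  change F.1.Nonempty ↔ _
  rw [neFace_iff_not_isBot, isBot_iff_eq_bot]

/-- Reindexing pairs of faces `G ⊆ F ⊆ P`. -/
noncomputable def flagEquiv (P : Polytope) :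
    (Σ F : P.L, (P.face F).L) ≃ (Σ G : P.L, (P.facePolytope G).L) :=
  (Equiv.sigmaCongrRight fun F => (P.faceIso F).toEquiv).trans
    (Equiv.trans
      { toFun := fun x => ⟨x.2.1, x.1, x.2.2⟩
        invFun := fun x => ⟨x.2.1, x.1, x.2.2⟩
        left_inv := fun _ => rfl
        right_inv := fun _ => rfl }
      (Equiv.sigmaCongrRight fun G => (P.facePolytopeIso G).symm.toEquiv))

lemma coassoc : (TensorProduct.assoc ℤ RP RP RP).toLinearMap ∘ₗ comul.rTensor RP ∘ₗ comul =
    comul.lTensor RP ∘ₗ comul := by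
  refine hom_ext fun P => ?_
  simp only [LinearMap.comp_apply, comul_of, map_sum, LinearMap.rTensor_tmul,
    LinearMap.lTensor_tmul, TensorProduct.sum_tmul, TensorProduct.tmul_sum]
  rw [← Fintype.sum_sigma', ← Fintype.sum_sigma']
  refine Fintype.sum_equiv (flagEquiv P) _ _ ?_
  rintro ⟨F, G⟩
  have h1 : flagEquiv P ⟨F, G⟩ = ⟨(P.faceIso F G).1, (P.facePolytopeIso _).symm
    ⟨F, (P.faceIso F G).2⟩⟩ := rfl
  set H : (P.facePolytope (P.faceIso F G).1).L := (P.facePolytopeIso _).symm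
    ⟨F, (P.faceIso F G).2⟩ with hH
  have hH' : P.facePolytopeIso (P.faceIso F G).1 H = ⟨F, (P.faceIso F G).2⟩ := by simp [hH]
  rw [h1]
  have e1 : (P.face F).face G ≈ P.face (P.faceIso F G).1 :=
    ⟨((P.face F).faceIso G).trans ((iicIso (P.faceIso F) G).trans ((iicIic _).trans
      (P.faceIso _).symm))⟩
  have e2 : (P.face F).facePolytope G ≈ (P.facePolytope (P.faceIso F G).1).face H := by
    refine ⟨((P.face F).facePolytopeIso G).trans ((iciIso (P.faceIso F) G).trans
      ((iciIic _).trans (OrderIso.trans ?_ ((P.facePolytope _).faceIso H).symm)))⟩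
    have := (iicIso (P.facePolytopeIso (P.faceIso F G).1) H).trans (iicIci _)
    rw [hH'] at this
    exact this.symm
  have e3 : P.facePolytope F ≈ (P.facePolytope (P.faceIso F G).1).facePolytope H := by
    refine ⟨(P.facePolytopeIso F).trans (OrderIso.trans ?_
      ((P.facePolytope _).facePolytopeIso H).symm)⟩
    have := (iciIso (P.facePolytopeIso (P.faceIso F G).1) H).trans (iciIci _)
    rw [hH'] at this
    exact this.symm
  change of _ ⊗ₜ[ℤ] (of _ ⊗ₜ[ℤ] of _) = _
  rw [of_congr e1, of_congr e2, of_congr e3]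

noncomputable instance instCoalgebra : Coalgebra ℤ RP where
  comul := comul
  counit := counit
  coassoc := coassoc
  rTensor_counit_comp_comul := by
    refine hom_ext fun P => ?_
    simp only [LinearMap.comp_apply, comul_of, map_sum, LinearMap.rTensor_tmul, counit_of,
      face_nonempty_iff]
    rw [Finset.sum_eq_single ⊥ (fun F _ hF => by simp [hF]) (by simp)]
    simp [of_congr (facePolytope_bot_equiv P)]
  lTensor_counit_comp_comul := by
    refine hom_ext fun P => ?_
    simp only [LinearMap.comp_apply, comul_of, map_sum, LinearMap.lTensor_tmul, counit_of,
      facePolytope_nonempty_iff]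
    rw [Finset.sum_eq_single ⊤ (fun F _ hF => by simp [hF]) (by simp)]
    simp [of_congr (face_top_equiv P)]

lemma comul_mul (a b : RP) : comul (a * b) = comul a * comul b := by
  have : (LinearMap.mul ℤ RP).compr₂ comul =
      (LinearMap.mul ℤ (RP ⊗[ℤ] RP)).compl₁₂ comul comul := by
    refine hom_ext fun P => hom_ext fun Q => ?_
    change comul (of P * of Q) = comul (of P) * comul (of Q)
    obtain ⟨e⟩ := exists_joinIso P Q
    rw [of_mul, comul_of, comul_of, comul_of, Finset.sum_mul_sum, ← Fintype.sum_prod_type']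
    refine Fintype.sum_equiv e.toEquiv _ _ fun K => ?_
    rw [Algebra.TensorProduct.tmul_mul_tmul]
    congr 1
    · refine (of_mul_of ?_).symm
      exact (prodCongrIso (P.faceIso _) (Q.faceIso _)).trans ((iicProd _ _).symm.trans
        ((iicIso e K).symm.trans ((P.join Q).faceIso K).symm))
    · refine (of_mul_of ?_).symm
      exact (prodCongrIso (P.facePolytopeIso _) (Q.facePolytopeIso _)).trans ((iciProd _ _).symm.trans
        ((iciIso e K).symm.trans ((P.join Q).facePolytopeIso K).symm))
  exact DFunLike.congr_fun (DFunLike.congr_fun this a) b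

lemma counit_mul (a b : RP) : counit (a * b) = counit a * counit b := by
  have : (LinearMap.mul ℤ RP).compr₂ counit = (LinearMap.mul ℤ ℤ).compl₁₂ counit counit := by
    refine hom_ext fun P => hom_ext fun Q => ?_
    change counit (of P * of Q) = counit (of P) * counit (of Q)
    have h : (P.join Q).carrier.Nonempty ↔ P.carrier.Nonempty ∨ Q.carrier.Nonempty := by
      rw [join, ofSet, Set.image_nonempty, convexHull_nonempty_iff, joinSet, Set.union_nonempty,
        Set.image_nonempty, Set.image_nonempty]
    rw [of_mul, counit_of, counit_of, counit_of, h]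
    by_cases h1 : P.carrier.Nonempty <;> by_cases h2 : Q.carrier.Nonempty <;> simp [h1, h2]
  exact DFunLike.congr_fun (DFunLike.congr_fun this a) b

noncomputable instance instBialgebra : Bialgebra ℤ RP :=
  Bialgebra.mk' ℤ RP
    (by
      change counit 1 = 1
      rw [← of_empty, counit_of, if_neg (by simp [Polytope.empty])])
    (counit_mul _ _)
    (by
      change comul 1 = 1
      rw [← of_empty, comul_of, Fintype.sum_unique]
      have h1 : (Polytope.empty.face default) ≈ Polytope.empty := face_top_equiv _
      have h2 : (Polytope.empty.facePolytope default) ≈ Polytope.empty :=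
        facePolytope_bot_equiv _
      rw [of_congr h1, of_congr h2]
      rfl)
    (comul_mul _ _)

end RP

end PolyHopf

namespace PolyHopf
open scoped TensorProduct

open Polytope

namespace RP

lemma conv_of (f g : WithConv (RP →ₗ[ℤ] RP)) (P : Polytope) :
    (f * g).ofConv (of P) =
      ∑ F : P.L, f.ofConv (of (P.face F)) * g.ofConv (of (P.facePolytope F)) := by
  change LinearMap.mul' ℤ RP (TensorProduct.map f.ofConv g.ofConv (comul (of P))) = _
  simp only [comul_of, map_sum, TensorProduct.map_tmul, LinearMap.mul'_apply]

/-- The reduced identity `η ε - id` in the convolution ring. -/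
noncomputable def negReduced : WithConv (RP →ₗ[ℤ] RP) := 1 - WithConv.toConv LinearMap.id

lemma negReduced_of_empty {P : Polytope} (h : ¬ P.carrier.Nonempty) :
    negReduced.ofConv (of P) = 0 := by
  have hP : of P = 1 := by
    rw [← of_empty]
    refine of_congr ⟨?_⟩
    have : Subsingleton P.L := ⟨fun F G => Subtype.ext (by
      rw [Set.not_nonempty_iff_eq_empty] at h
      rw [Set.subset_eq_empty F.2.subset h, Set.subset_eq_empty G.2.subset h])⟩
    exact { toFun := fun _ => ⊥, invFun := fun _ => ⊥, left_inv := fun _ => Subsingleton.elim _ _,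
            right_inv := fun _ => Subsingleton.elim _ _,
            map_rel_iff' := fun {a b} => by simp [Subsingleton.elim a b] }
  change (1 : WithConv (RP →ₗ[ℤ] RP)).ofConv (of P) - of P = 0
  rw [LinearMap.convOne_apply]
  change algebraMap ℤ RP (counit (of P)) - of P = 0
  rw [counit_of, if_neg h, hP, map_one, sub_self]

lemma negReduced_pow_of : ∀ (k : ℕ) (P : Polytope), P.rank < k →
    (negReduced ^ k).ofConv (of P) = 0 := by
  intro k
  induction k with
  | zero => intro P h; omega
  | succ k ih =>
    intro P h
    rw [pow_succ, conv_of]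
    refine Finset.sum_eq_zero fun F _ => ?_
    by_cases hF : F = ⊤
    · rw [negReduced_of_empty (by rw [facePolytope_nonempty_iff]; simpa using hF), mul_zero]
    · rw [ih _ (by have := rank_face_lt hF; omega), zero_mul]

/-- Partial sums of the geometric series of `negReduced`. -/
noncomputable def geomSum (n : ℕ) : WithConv (RP →ₗ[ℤ] RP) :=
  ∑ k ∈ Finset.range n, negReduced ^ k

lemma geomSum_of {P : Polytope} {m n : ℕ} (hm : P.rank < m) (hmn : m ≤ n) :
    (geomSum n).ofConv (of P) = (geomSum m).ofConv (of P) := by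
  induction n, hmn using Nat.le_induction with
  | base => rfl
  | succ n hn ih =>
    rw [geomSum, Finset.sum_range_succ, ← geomSum]
    change (geomSum n).ofConv (of P) + (negReduced ^ n).ofConv (of P) = _
    rw [ih, negReduced_pow_of n P (by omega), add_zero]

/-- The antipode, as the convolution inverse `∑_k (η ε - id)^k` of the identity (a finite sum on
each polytope). -/
noncomputable def antipode : RP →ₗ[ℤ] RP :=
  lift (fun P => (geomSum (P.rank + 1)).ofConv (of P)) fun P Q h => by
    rw [rank_congr h, of_congr h]

lemma antipode_of {P : Polytope} {n : ℕ} (h : P.rank < n) :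
    antipode (of P) = (geomSum n).ofConv (of P) := by
  rw [antipode, lift_of, geomSum_of (Nat.lt_succ_self _) h]

lemma one_sub_negReduced : 1 - negReduced = WithConv.toConv (LinearMap.id : RP →ₗ[ℤ] RP) := by
  rw [negReduced, sub_sub_cancel]

lemma one_sub_pow_of {P : Polytope} {n : ℕ} (h : P.rank < n) :
    (1 - negReduced ^ n).ofConv (of P) = algebraMap ℤ RP (counit (of P)) := by
  change (1 : WithConv (RP →ₗ[ℤ] RP)).ofConv (of P) - (negReduced ^ n).ofConv (of P) = _
  rw [negReduced_pow_of n P h, sub_zero]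
  exact LinearMap.convOne_apply _

/-- The Hopf algebra `ℛ𝒫`. -/
noncomputable instance instHopfAlgebra : HopfAlgebra ℤ RP where
  antipode := antipode
  mul_antipode_rTensor_comul := by
    refine hom_ext fun P => ?_
    change LinearMap.mul' ℤ RP (antipode.rTensor RP (comul (of P))) =
      algebraMap ℤ RP (counit (of P))
    have h := geom_sum_mul_neg negReduced (P.rank + 1)
    rw [one_sub_negReduced, ← geomSum] at h
    rw [← one_sub_pow_of (Nat.lt_succ_self P.rank), ← h, conv_of]
    simp only [comul_of, map_sum, LinearMap.rTensor_tmul, LinearMap.mul'_apply]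
    refine Finset.sum_congr rfl fun F _ => ?_
    rw [antipode_of (n := P.rank + 1)]
    · rfl
    · by_cases hF : F = ⊤
      · subst hF
        exact Nat.lt_succ_self _
      · exact (rank_face_lt hF).trans (Nat.lt_succ_self _)
  mul_antipode_lTensor_comul := by
    refine hom_ext fun P => ?_
    change LinearMap.mul' ℤ RP (antipode.lTensor RP (comul (of P))) =
      algebraMap ℤ RP (counit (of P))
    set n := (∑ F : P.L, (P.facePolytope F).rank) + P.rank + 1 with hn
    have h := mul_neg_geom_sum negReduced n
    rw [one_sub_negReduced, ← geomSum] at h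
    rw [← one_sub_pow_of (n := n) (by omega), ← h, conv_of]
    simp only [comul_of, map_sum, LinearMap.lTensor_tmul, LinearMap.mul'_apply]
    refine Finset.sum_congr rfl fun F _ => ?_
    rw [antipode_of (n := n)]
    · rfl
    · have := Finset.single_le_sum (f := fun F : P.L => (P.facePolytope F).rank)
        (fun _ _ => Nat.zero_le _) (Finset.mem_univ F)
      omega

end RP

end PolyHopf

namespace PolyHopf
open scoped TensorProduct

open Polytope

/-! ### Hopf comodules and the coaction of `ℛ𝒫` on `𝒫` -/

/-- A linear map `b : M → M ⊗ X` makes the `R`-algebra `M` a right Hopf comodule over the Hopf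
algebra `X`: `b` is coassociative, counital, and a homomorphism of rings. -/
structure IsRightHopfComodule (R X M : Type*) [CommRing R] [Ring X] [HopfAlgebra R X] [Ring M]
    [Algebra R M] (b : M →ₗ[R] M ⊗[R] X) : Prop where
  coassoc : (TensorProduct.assoc R M X X).toLinearMap ∘ₗ b.rTensor X ∘ₗ b =
    (Coalgebra.comul (R := R) (A := X)).lTensor M ∘ₗ b
  counit : (Coalgebra.counit (R := R) (A := X)).lTensor M ∘ₗ b =
    (TensorProduct.mk R M R).flip 1
  map_one : b 1 = 1
  map_mul : ∀ x y : M, b (x * y) = b x * b y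

namespace PolytopeRing

/-- The coaction `Δ_{ℛ𝒫} P = ∑_{F ⊆ P} F ⊗ P/F`, the sum over all nonempty faces of `P`. -/
noncomputable def coaction : PolytopeRing →ₗ[ℤ] PolytopeRing ⊗[ℤ] RP :=
  lift (fun P => ∑ F : NeFace P.carrier, of (P.face F) ⊗ₜ[ℤ] RP.of (P.facePolytope F))
    fun P Q ⟨e⟩ => Fintype.sum_equiv (neIso e).toEquiv _ _ fun F => by
      rw [of_congr (NePolytope.face_congr e F),
        RP.of_congr (NePolytope.facePolytope_congr e F)]
      rfl

/-- The component of `𝒫` of degree `2n`, spanned by the `n`-dimensional polytopes. -/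
noncomputable def grading (n : ℕ) : Submodule ℤ PolytopeRing :=
  Submodule.span ℤ {x | ∃ P : NePolytope, P.dim = n ∧ of P = x}

end PolytopeRing

/-- The component of `ℛ𝒫` of degree `2n`, spanned by the `(n-1)`-dimensional polytopes. -/
noncomputable def RP.grading (n : ℕ) : Submodule ℤ RP :=
  Submodule.span ℤ {x | ∃ P : Polytope, P.rank = n ∧ RP.of P = x}

/-- The component of `𝒫 ⊗ ℛ𝒫` of degree `2n`. -/
noncomputable def tensorGrading (n : ℕ) : Submodule ℤ (PolytopeRing ⊗[ℤ] RP) :=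
  ⨆ p ∈ Finset.HasAntidiagonal.antidiagonal n,
    LinearMap.range (TensorProduct.map (PolytopeRing.grading p.1).subtype
      (RP.grading p.2).subtype)

/-! ### Quasi-symmetric functions -/

namespace Qsym

/-- The sequence of nonzero exponents of a monomial in `t₀, t₁, …`, in the order of the
variables. -/
def exponents (m : ℕ →₀ ℕ) : List ℕ := (m.support.sort (· ≤ ·)).map m

lemma exponents_embDomain (φ : ℕ ↪o ℕ) (m : ℕ →₀ ℕ) :
    exponents (m.embDomain φ.toEmbedding) = exponents m := by
  rw [exponents, Finsupp.support_embDomain, exponents,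
    ← Finset.map_sort (r := (· ≤ ·)) (r' := (· ≤ ·)), List.map_map]
  · refine List.map_congr_left fun i _ => ?_
    exact Finsupp.embDomain_apply_self _ _ _
  · intro a _ b _
    exact φ.le_iff_le.symm

lemma sum_exponents (m : ℕ →₀ ℕ) : (exponents m).sum = m.degree := by
  rw [exponents, Finsupp.degree_apply, ← Finset.sum_map_toList,
    ((m.support.sort_perm_toList (· ≤ ·)).map m).sum_eq]

lemma degree_embDomain (φ : ℕ ↪o ℕ) (m : ℕ →₀ ℕ) :
    (m.embDomain φ.toEmbedding).degree = m.degree := by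
  rw [← sum_exponents, ← sum_exponents, exponents_embDomain]

end Qsym

/-- The ring of quasi-symmetric functions over `ℤ`: the power series of bounded degree in
countably many variables whose coefficients do not change when the variables of a monomial are
replaced, in the same order, by others. -/
def Qsym : Subring (MvPowerSeries ℕ ℤ) where
  carrier := {g | (∃ N, ∀ m : ℕ →₀ ℕ, N < m.degree → MvPowerSeries.coeff m g = 0) ∧
    ∀ (φ : ℕ ↪o ℕ) (m : ℕ →₀ ℕ),
      MvPowerSeries.coeff (m.embDomain φ.toEmbedding) g = MvPowerSeries.coeff m g}
  zero_mem' := by simp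
  one_mem' := by
    classical
    refine ⟨⟨0, fun m hm => ?_⟩, fun φ m => ?_⟩
    · rw [MvPowerSeries.coeff_one, if_neg]
      rintro rfl
      simp at hm
    · simp [MvPowerSeries.coeff_one]
  add_mem' := by
    rintro g h ⟨⟨N, hN⟩, hg⟩ ⟨⟨N', hN'⟩, hh⟩
    refine ⟨⟨N + N', fun m hm => ?_⟩, fun φ m => ?_⟩
    · rw [map_add, hN m (by omega), hN' m (by omega), add_zero]
    · rw [map_add, map_add, hg, hh]
  neg_mem' := by
    rintro g ⟨⟨N, hN⟩, hg⟩
    refine ⟨⟨N, fun m hm => ?_⟩, fun φ m => ?_⟩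
    · rw [map_neg, hN m hm, neg_zero]
    · rw [map_neg, map_neg, hg]
  mul_mem' := by
    classical
    rintro g h ⟨⟨N, hN⟩, hg⟩ ⟨⟨N', hN'⟩, hh⟩
    refine ⟨⟨N + N', fun m hm => ?_⟩, fun φ m => ?_⟩
    · rw [MvPowerSeries.coeff_mul]
      refine Finset.sum_eq_zero fun p hp => ?_
      rw [Finset.HasAntidiagonal.mem_antidiagonal] at hp
      have : m.degree = p.1.degree + p.2.degree := by rw [← hp, map_add]
      rcases lt_or_ge N p.1.degree with h1 | h1
      · rw [hN _ h1, zero_mul]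
      · rw [hN' _ (by omega), mul_zero]
    · rw [MvPowerSeries.coeff_mul, MvPowerSeries.coeff_mul,
        ← Finsupp.image_prodMap_embDomain_antidiagonal, Finset.sum_image]
      · exact Finset.sum_congr rfl fun p _ => by simp only [Prod.map_fst, Prod.map_snd, hg, hh]
      · intro p _ q _ hpq
        exact Prod.map_injective.2 ⟨Finsupp.embDomain_injective _, Finsupp.embDomain_injective _⟩ hpq

namespace Qsym

/-- The quasi-symmetric monomial `M_ω = ∑_{l₁ < ⋯ < l_k} t_{l₁}^{j₁} ⋯ t_{l_k}^{j_k}` of a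
composition `ω = (j₁, …, j_k)`. -/
def monomial (ω : List ℕ) : Qsym :=
  ⟨fun m => if exponents m = ω then 1 else 0, by
    refine ⟨⟨ω.sum, fun m hm => ?_⟩, fun φ m => ?_⟩
    · change (if exponents m = ω then (1 : ℤ) else 0) = 0
      rw [if_neg]
      rintro rfl
      rw [sum_exponents] at hm
      exact lt_irrefl _ hm
    · change (if exponents _ = ω then (1 : ℤ) else 0) = if exponents m = ω then 1 else 0
      rw [exponents_embDomain]⟩

/-- The monomial `t₀^{j₁} ⋯ t_{k-1}^{j_k}`. -/
noncomputable def pack (l : List ℕ) : ℕ →₀ ℕ := ∑ i : Fin l.length, Finsupp.single (i : ℕ) (l.get i)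

lemma degree_pack (l : List ℕ) : (pack l).degree = l.sum := by
  simp [pack, map_sum]

/-- The involution `*` of the ring of quasi-symmetric functions with `M_ω ↦ M_{ω*}`, where `ω*` is
the reversed composition. -/
noncomputable def star : Qsym →ₗ[ℤ] Qsym where
  toFun g := ⟨fun m => MvPowerSeries.coeff (pack (exponents m).reverse) g.1, by
    obtain ⟨g, ⟨N, hN⟩, -⟩ := g
    refine ⟨⟨N, fun m hm => hN _ ?_⟩, fun φ m => ?_⟩
    · rw [degree_pack, List.sum_reverse, sum_exponents]
      exact hm
    · change MvPowerSeries.coeff (pack (exponents _).reverse) g =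
        MvPowerSeries.coeff (pack (exponents m).reverse) g
      rw [exponents_embDomain]⟩
  map_add' _ _ := rfl
  map_smul' _ _ := rfl

lemma exponents_pack {l : List ℕ} (hl : ∀ j ∈ l, j ≠ 0) : exponents (pack l) = l := by
  have h : ∀ i (hi : i < l.length), pack l i = l[i] := by
    intro i hi
    rw [pack, Finsupp.finsetSum_apply, Finset.sum_eq_single ⟨i, hi⟩]
    · simp
    · intro b _ hb
      exact Finsupp.single_eq_of_ne fun h => hb (Fin.ext h.symm)
    · simp
  have h' : ∀ i, l.length ≤ i → pack l i = 0 := by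
    intro i hi
    rw [pack, Finsupp.finsetSum_apply]
    refine Finset.sum_eq_zero fun b _ => Finsupp.single_eq_of_ne ?_
    omega
  have hs : (pack l).support = Finset.range l.length := by
    ext i
    rw [Finsupp.mem_support_iff, Finset.mem_range]
    constructor
    · exact fun hi => not_le.1 fun hc => hi (h' i hc)
    · exact fun hi => by rw [h i hi]; exact hl _ (List.getElem_mem hi)
  rw [exponents, hs, Finset.sort_range]
  refine List.ext_getElem (by simp) fun i h1 h2 => ?_
  simp [h i h2]

lemma star_monomial (ω : List ℕ) : star (monomial ω) = monomial ω.reverse := by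
  apply Subtype.ext
  funext m
  change (if exponents (pack (exponents m).reverse) = ω then (1 : ℤ) else 0) =
    if exponents m = ω.reverse then 1 else 0
  rw [exponents_pack]
  · exact if_congr List.reverse_eq_iff rfl rfl
  intro j hj
  rw [List.mem_reverse, exponents, List.mem_map] at hj
  obtain ⟨i, hi, rfl⟩ := hj
  exact Finsupp.mem_support_iff.1 ((Finset.mem_sort _).1 hi)

end Qsym

/-! ### Face operators, flags, and the homomorphisms to quasi-symmetric functions -/

namespace Polytope

/-- The rank `dim F + 1` of a face. -/
noncomputable def faceRank (P : Polytope) (F : P.L) : ℕ := (P.face F).rank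

lemma faceRank_congr {P Q : Polytope} (e : P.L ≃o Q.L) (F : P.L) :
    Q.faceRank (e F) = P.faceRank F := (rank_congr (face_congr e F)).symm

lemma isChain_map {P Q : Polytope} (e : P.L ≃o Q.L) (s : Finset P.L) :
    IsChain (· ≤ ·) ((s.map e.toEquiv.toEmbedding : Finset Q.L) : Set Q.L) ↔
      IsChain (· ≤ ·) (s : Set P.L) := by
  rw [Finset.coe_map]
  constructor
  · intro h x hx y hy hxy
    simpa using h ⟨x, hx, rfl⟩ ⟨y, hy, rfl⟩ (e.injective.ne hxy)
  · rintro h _ ⟨x, hx, rfl⟩ _ ⟨y, hy, rfl⟩ hxy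
    simpa using h hx hy fun hc => hxy (by rw [hc])

lemma image_faceRank_map {P Q : Polytope} (e : P.L ≃o Q.L) (s : Finset P.L) :
    (s.map e.toEquiv.toEmbedding).image Q.faceRank = s.image P.faceRank := by
  rw [Finset.map_eq_image, Finset.image_image]
  exact Finset.image_congr fun F _ => faceRank_congr e F

open Classical in
/-- The flag number `f_S`: the number of chains of faces of `P` whose dimensions are exactly the
elements of `S`. -/
noncomputable def flagNumber (P : Polytope) (S : Finset ℕ) : ℕ :=
  (Finset.univ.filter fun s : Finset P.L =>
    IsChain (· ≤ ·) (s : Set P.L) ∧ s.image P.faceRank = S.image (· + 1)).card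

lemma flagNumber_congr {P Q : Polytope} (h : P ≈ Q) (S : Finset ℕ) :
    P.flagNumber S = Q.flagNumber S := by
  classical
  obtain ⟨e⟩ := h
  refine Finset.card_equiv e.toEquiv.finsetCongr fun s => ?_
  simp only [Finset.mem_filter, Finset.mem_univ, true_and, Equiv.finsetCongr_apply,
    isChain_map, image_faceRank_map]

end Polytope

/-- The successive differences `(a₂ - a₁, …, a_k - a_{k-1})` of `{a₁ < ⋯ < a_k}`. -/
def gaps (S : Finset ℕ) : List ℕ :=
  List.zipWith (fun a b => b - a) (S.sort (· ≤ ·)) (S.sort (· ≤ ·)).tail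

open Classical in
/-- The Ehrenborg map `F(P) = ∑ M_{(ρ(x₀,x₁), …, ρ(x_k,x_{k+1}))}`, the sum over all chains
`∅ = x₀ < x₁ < ⋯ < x_{k+1} = P` in the face lattice of `P`. -/
noncomputable def ehrenborg : RP →ₗ[ℤ] Qsym :=
  RP.lift (fun P => ∑ s ∈ Finset.univ.filter fun s : Finset P.L =>
      IsChain (· ≤ ·) (s : Set P.L) ∧ ⊥ ∈ s ∧ ⊤ ∈ s, Qsym.monomial (gaps (s.image P.faceRank)))
    fun P Q ⟨e⟩ => Finset.sum_equiv e.toEquiv.finsetCongr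
      (fun s => by
        have hb : (⊥ : Q.L) ∈ s.map e.toEquiv.toEmbedding ↔ ⊥ ∈ s := by
          rw [← e.map_bot]; exact Finset.mem_map' e.toEquiv.toEmbedding
        have ht : (⊤ : Q.L) ∈ s.map e.toEquiv.toEmbedding ↔ ⊤ ∈ s := by
          rw [← e.map_top]; exact Finset.mem_map' e.toEquiv.toEmbedding
        simp only [Finset.mem_filter, Finset.mem_univ, true_and, Equiv.finsetCongr_apply,
          isChain_map, hb, ht])
      (fun s _ => by rw [Equiv.finsetCongr_apply, image_faceRank_map])

/-- The homomorphism `F* = * ∘ F`. -/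
noncomputable def ehrenborgStar : RP →ₗ[ℤ] Qsym := Qsym.star ∘ₗ ehrenborg

namespace PolytopeRing

lemma dim_face_congr {P Q : NePolytope} (e : P.L ≃o Q.L) (F : NeFace P.carrier) :
    (Q.face (neIso e F)).dim = (P.face F).dim :=
  (dim_congr (NePolytope.face_congr e F) F.2).symm

/-- The face operator `d_k` on `𝒫`: an `n`-dimensional polytope is sent to the sum of its
`(n-k)`-dimensional (nonempty) faces. -/
noncomputable def d (k : ℕ) : PolytopeRing →ₗ[ℤ] PolytopeRing :=
  lift (fun P => ∑ F : NeFace P.carrier with (P.face F).dim + k = P.dim, of (P.face F))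
    fun P Q ⟨e⟩ => Finset.sum_equiv (neIso e).toEquiv
      (fun F => by
        have h1 : (Q.face ((neIso e).toEquiv F)).dim = (P.face F).dim := dim_face_congr e F
        have h2 : Q.dim = P.dim := (dim_congr ⟨e⟩ P.nonempty).symm
        simp only [Finset.mem_filter, Finset.mem_univ, true_and, h1, h2])
      (fun F _ => of_congr (NePolytope.face_congr e F))

/-- The operator `d_{j₁} ⋯ d_{j_k}` (the last factor is applied first). -/
noncomputable def dWord (l : List ℕ) (x : PolytopeRing) : PolytopeRing :=
  l.foldr (fun j y => d j y) x

/-- The coaction `Δ_ℒ P = ∑ (d_{j₁} ⋯ d_{j_k} P) ⊗ M_{(j₁, …, j_k)}`, the sum over all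
compositions of the numbers `0, …, dim P` (the other compositions contribute zero). -/
noncomputable def coactionL : PolytopeRing →ₗ[ℤ] PolytopeRing ⊗[ℤ] Qsym :=
  lift (fun P => ∑ n ∈ Finset.range (P.dim + 1), ∑ c : Composition n,
      dWord c.blocks (of P) ⊗ₜ[ℤ] Qsym.monomial c.blocks)
    fun P Q h => by rw [of_congr h, dim_congr h P.nonempty]

open Polynomial in
/-- The homomorphism `l_α : 𝒫 → ℛ𝒫[α]`, `l_α P = ∑_{F ⊆ P} α^{dim F} P/F`, the sum over all
nonempty faces. -/
noncomputable def lAlpha : PolytopeRing →ₗ[ℤ] RP[X] :=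
  lift (fun P => ∑ F : NeFace P.carrier,
      Polynomial.monomial (P.face F).dim (RP.of (P.facePolytope F)))
    fun P Q ⟨e⟩ => Fintype.sum_equiv (neIso e).toEquiv _ _ fun F => by
      rw [RP.of_congr (NePolytope.facePolytope_congr e F), ← dim_face_congr e F]
      rfl

open Polynomial in
/-- The generalized `f`-polynomial `f(P) = ∑_S f_S α^{a₁} M_{(n - a_k, …, a₂ - a₁)}` of an
`n`-dimensional polytope, the sum over all `S = {a₁ < ⋯ < a_k} ⊆ {0, …, n-1}`; the term of `S = ∅`
is `α^n`. -/
noncomputable def fPolynomial : PolytopeRing →ₗ[ℤ] Qsym[X] :=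
  lift (fun P => ∑ S ∈ (Finset.range P.dim).powerset,
      P.flagNumber S • Polynomial.monomial ((insert P.dim S).min' (Finset.insert_nonempty _ _))
        (Qsym.monomial (gaps (insert P.dim S)).reverse))
    fun P Q h => by simp only [dim_congr h P.nonempty, flagNumber_congr h]

end PolytopeRing

open Polynomial in
/-- The extension of `F*` to a map `ℛ𝒫[α] → Qsym[α]`, applied to each coefficient. -/
noncomputable def ehrenborgStarPoly (p : RP[X]) : Qsym[X] :=
  p.sum fun n a => Polynomial.monomial n (ehrenborgStar a)

end PolyHopf

open PolyHopf
open scoped TensorProduct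

/-! Almost everything is a statement about intervals of the face lattice `L(P)`. For nested faces `∅
≠ G ⊆ F ⊆ P`, the polytope `F/G` is a face of `P/G`, and dividing `P/G` by it gives `P/F`, because
an interval of an interval is an interval. Hence both sides of coassociativity are the sum of `G ⊗
F/G ⊗ P/F` over nested pairs. Counitality holds because `P/F` is empty only for `F = P`. The
coaction is multiplicative because the nonempty faces of `P × Q` are the products `F × G` of
nonempty faces, and the interval above `F × G` is `[F, P] × [G, Q]`, which is the face lattice of
the join of `P/F` and `Q/G`.

Degrees need geometry: the lattice is graded, `dim P/F = dim P - dim F - 1` (`rank_facePolytope`).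
As `P/F` is known only through its lattice, this is proved by induction on rank, comparing facets of
`P/F` with facets of `P` that contain `F`; the latter exist by `exists_facet_ge`.

For the two identities, gradedness turns the Ehrenborg image of `P/F` into a sum of `M_ω` over the
chains of `L(P)` from `F` up to `P`, where `ω` lists the rank differences from bottom to top
(`ehrenborg_facePolytope`). So both left sides become sums over pairs of a nonempty face `F` and a
chain from `F` to `P`. The operator `d_{j₁} ⋯ d_{j_k}` builds such chains from `P` downwards and
yields `F` once for each chain of type `(j₁, …, j_k)` (`dWord_of`); thus `Δ_ℒ` is the first sum
grouped by type. Deleting `P` from a chain leaves a flag of nonempty proper faces, and the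
involution `*` reverses its type; thus `f` is the second sum grouped by the set of dimensions of the
flag. -/

namespace PolyHopf

open Polytope

/-! ### Gradedness of the face lattice -/

namespace Polytope

/-- Every proper face is contained in a facet. -/
lemma exists_facet_ge {P : Polytope} {F₀ : P.L} (hF₀ : F₀ ≠ ⊤) :
    ∃ F : P.L, F₀ ≤ F ∧ F ≠ ⊤ ∧ P.rank ≤ (P.face F).rank + 1 := by
  classical
  have hP : P.carrier.Nonempty :=
    nonempty_iff.2 fun h => hF₀ (top_unique (h ▸ bot_le))
  -- A proper face of maximal rank above `F₀` is a facet: if its rank fell short by two or more, its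
  -- supporting hyperplane could be tilted to give a larger proper face.
  obtain ⟨F, hF, hmax⟩ := Finset.exists_max_image (Finset.univ.filter fun F : P.L => F₀ ≤ F ∧ F ≠ ⊤)
    (fun F => (P.face F).rank) ⟨F₀, by simp [hF₀]⟩
  obtain ⟨hF₀F, hF⟩ := (Finset.mem_filter.1 hF).2
  have hmax : ∀ G : P.L, F ≤ G → G ≠ ⊤ → (P.face G).rank ≤ (P.face F).rank :=
    fun G hFG hG => hmax G (by simp [hG, hF₀F.trans hFG])
  refine ⟨F, hF₀F, hF, not_lt.1 fun hlt => ?_⟩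
  obtain ⟨V, hV⟩ := P.isPolytope
  have hVS : ∀ x ∈ V, x ∈ P.carrier := fun x hx => by rw [hV]; exact subset_convexHull _ _ hx
  have constOn : ∀ (h : (Fin P.ambient → ℝ) →ₗ[ℝ] ℝ) (k : ℝ), (∀ x ∈ V, h x = k) →
      ∀ x ∈ P.carrier, h x = k := by
    intro h k hk x hx
    rw [hV] at hx
    exact convexHull_min (t := {x | h x = k}) hk (convex_hyperplane h.isLinear k) hx
  have validOn : ∀ (h : (Fin P.ambient → ℝ) →ₗ[ℝ] ℝ) (k : ℝ), (∀ x ∈ V, h x ≤ k) →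
      ∀ x ∈ P.carrier, h x ≤ k := by
    intro h k hk x hx
    rw [hV] at hx
    exact valid_convexHull hk x hx
  by_cases hFn : F.1.Nonempty
  · obtain ⟨f, hf⟩ := hFn
    obtain ⟨g, m, hg, hFe⟩ := F.2
    rw [rank_of_nonempty (P := P.face F) ⟨f, hf⟩, rank_of_nonempty hP] at hlt
    have hfm : g f = m := by rw [hFe] at hf; exact hf.2
    obtain ⟨w, hwV, hwF⟩ : ∃ w ∈ V, g w ≠ m := by
      by_contra! hcon
      exact hF (Subtype.ext (F.2.subset.antisymm fun x hx => by
        rw [hFe]; exact ⟨hx, constOn g m hcon x hx⟩))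
    -- A functional vanishing on `D` is constant on `F` and takes the same value at the vertex `w`
    -- outside `F`. Codimension at least two leaves room for one that is not constant on `P`.
    -- Keeping `w` fixed ensures that the tilted face stays proper.
    set D := vectorSpan ℝ F.1 ⊔ Submodule.span ℝ {w - f} with hD
    have hDlt : Module.finrank ℝ D < Module.finrank ℝ (vectorSpan ℝ P.carrier) := by
      have h1 := Submodule.finrank_add_le_finrank_add_finrank (vectorSpan ℝ F.1)
        (Submodule.span ℝ {w - f})
      have h2 := (finrank_span_le_card (R := ℝ) ({w - f} : Set (Fin P.ambient → ℝ))).trans_eq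
        (by simp : _ = 1)
      have h3 : (P.face F).dim = Module.finrank ℝ (vectorSpan ℝ F.1) := rfl
      have h4 : P.dim = Module.finrank ℝ (vectorSpan ℝ P.carrier) := rfl
      rw [hD]
      omega
    obtain ⟨v, hv, hvD⟩ : ∃ v ∈ vectorSpan ℝ P.carrier, v ∉ D := by
      by_contra! hcon
      exact absurd (Submodule.finrank_mono (fun v hv => hcon v hv)) (not_le.2 hDlt)
    obtain ⟨h, hvne, hDk⟩ := Submodule.exists_le_ker_of_notMem hvD
    have main : ∀ h : (Fin P.ambient → ℝ) →ₗ[ℝ] ℝ, D ≤ LinearMap.ker h →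
        (∃ x ∈ V, h f < h x) → False := by
      intro h hDk hx
      have hFk : ∀ x ∈ F.1, h x = h f := fun x hx => by
        have : h (x -ᵥ f) = 0 := hDk (le_sup_left (a := vectorSpan ℝ F.1)
          (vsub_mem_vectorSpan ℝ hx hf))
        rw [vsub_eq_sub, map_sub] at this
        linarith
      have hwk : h w = h f := by
        have : h (w - f) = 0 := hDk (le_sup_right (a := vectorSpan ℝ F.1)
          (Submodule.mem_span_singleton_self _))
        rw [map_sub] at this
        linarith
      obtain ⟨y, hy, hmin⟩ := Finset.exists_min_image (V.filter fun x => h f < h x)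
        (fun x => (m - g x) / (h x - h f)) (by
          obtain ⟨x, hx, hx'⟩ := hx
          exact ⟨x, Finset.mem_filter.2 ⟨hx, hx'⟩⟩)
      obtain ⟨hyV, hyh⟩ := Finset.mem_filter.1 hy
      -- The tilt is increased until the inequality `g + t h ≤ m + t h(f)` first becomes tight at a
      -- vertex where `h` exceeds `h f`; the vertex `y` with the smallest ratio is reached first.
      set t := (m - g y) / (h y - h f) with ht
      have ht0 : 0 ≤ t := div_nonneg (sub_nonneg.2 (hg y (hVS y hyV))) (sub_pos.2 hyh).le
      have hty : t * (h y - h f) = m - g y := div_mul_cancel₀ _ (sub_pos.2 hyh).ne'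
      have hval : ∀ x ∈ V, (g + t • h) x ≤ m + t * h f := by
        intro x hxV
        simp only [LinearMap.add_apply, LinearMap.smul_apply, smul_eq_mul]
        have h1 := hg x (hVS x hxV)
        rcases le_or_gt (h x) (h f) with hle | hgt
        · have := mul_le_mul_of_nonneg_left hle ht0
          linarith
        · have := hmin x (Finset.mem_filter.2 ⟨hxV, hgt⟩)
          rw [le_div_iff₀ (sub_pos.2 hgt)] at this
          linarith
      let G : P.L := ⟨{x ∈ P.carrier | (g + t • h) x = m + t * h f}, _, _,
        validOn _ _ hval, rfl⟩
      have hFG : F.1 ⊆ G.1 := fun x hx => ⟨F.2.subset hx, by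
        have h1 : g x = m := by rw [hFe] at hx; exact hx.2
        simp [h1, hFk x hx]⟩
      have hyG : y ∈ G.1 := ⟨hVS y hyV, by
        simp only [LinearMap.add_apply, LinearMap.smul_apply, smul_eq_mul]; linarith⟩
      have hyF : y ∉ F.1 := fun hc => absurd (hFk y hc) hyh.ne'
      have hGtop : G ≠ ⊤ := fun hc => hwF (by
        have : w ∈ G.1 := by rw [hc]; exact hVS w hwV
        have h2 := this.2
        simp only [LinearMap.add_apply, LinearMap.smul_apply, smul_eq_mul, hwk] at h2
        linarith)
      have h1 := hmax G hFG hGtop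
      have h2 : ((P.face G).face ⟨F.1, G.2.of_face_subset F.2 hFG⟩).rank < (P.face G).rank :=
        rank_face_lt fun hc => hyF (by
          have : F.1 = G.1 := congrArg (fun z : (P.face G).L => z.1) hc
          rw [this]; exact hyG)
      exact absurd h1 (not_le.2 h2)
    obtain ⟨x, hxV, hxne⟩ : ∃ x ∈ V, h x ≠ h f := by
      by_contra! hcon
      exact hvne (vectorSpan_le_ker (constOn h (h f) hcon) hv)
    -- The tilt needs a vertex where the functional exceeds its value on `F`; either `h` or `-h` has
    -- one.
    rcases hxne.lt_or_gt with hlt' | hgt'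
    · exact main (-h) (fun z hz => by have := hDk hz; simpa using this) ⟨x, hxV, by simpa using hlt'⟩
    · exact main h hDk ⟨x, hxV, hgt'⟩
  -- If `F` is empty, then `dim P ≥ 1`. The maximum of a coordinate separating two points of `P` is
  -- attained on a nonempty proper face, of larger rank than `F`.
  · rw [rank, if_neg (by exact hFn), rank_of_nonempty hP] at hlt
    have hdim : Module.finrank ℝ (vectorSpan ℝ P.carrier) ≠ 0 := by
      change P.dim ≠ 0
      omega
    obtain ⟨x, hx, y, hy, hxy⟩ : P.carrier.Nontrivial := by
      rw [← Set.not_subsingleton_iff]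
      intro hs
      rw [vectorSpan_of_subsingleton ℝ hs, finrank_bot] at hdim
      exact hdim rfl
    obtain ⟨i, hi⟩ := Function.ne_iff.1 hxy
    let g : (Fin P.ambient → ℝ) →ₗ[ℝ] ℝ := LinearMap.proj i
    have hVn : V.Nonempty := by
      rw [Finset.nonempty_iff_ne_empty]
      rintro rfl
      rw [hV] at hx
      simp at hx
    obtain ⟨z, hz, hzmax⟩ := Finset.exists_max_image V (fun x => g x) hVn
    let G : P.L := ⟨{x ∈ P.carrier | g x = g z}, _, _, validOn _ _ hzmax, rfl⟩
    have hGtop : G ≠ ⊤ := fun hc => hi (by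
      have h1 : x ∈ G.1 := by rw [hc]; exact hx
      have h2 : y ∈ G.1 := by rw [hc]; exact hy
      exact h1.2.trans h2.2.symm)
    have hFG : F ≤ G := fun x hx => (hFn ⟨x, hx⟩).elim
    have h1 := hmax G hFG hGtop
    rw [rank_of_nonempty (P := P.face G) ⟨z, hVS z hz, rfl⟩, rank, if_neg (by exact hFn)] at h1
    omega

/-- The interval `[F, P]` restricted below a face `G` above `F`. -/
lemma face_facePolytope_equiv {P : Polytope} (F : P.L) (H : (P.facePolytope F).L) :
    (P.facePolytope F).face H ≈ (P.face (P.facePolytopeIso F H).1).facePolytope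
      ((P.faceIso _).symm ⟨F, (P.facePolytopeIso F H).2⟩) := by
  set G := P.facePolytopeIso F H
  set K : (P.face G.1).L := (P.faceIso G.1).symm ⟨F, G.2⟩ with hK
  refine ⟨((P.facePolytope F).faceIso H).trans ((iicIso (P.facePolytopeIso F) H).trans
    ((iicIci _).trans (OrderIso.trans ?_ ((P.face G.1).facePolytopeIso K).symm)))⟩
  have := (iciIso (P.faceIso G.1) K).trans (iciIic _)
  rw [hK, OrderIso.apply_symm_apply] at this
  exact this.symm

lemma facePolytopeIso_top (P : Polytope) (F : P.L) : (P.facePolytopeIso F ⊤).1 = ⊤ := by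
  have h := (P.facePolytopeIso F).symm_apply_le.1
    (le_top (a := (P.facePolytopeIso F).symm ⟨⊤, (le_top : F ≤ ⊤)⟩))
  exact le_antisymm le_top h

lemma facePolytopeIso_bot (P : Polytope) (F : P.L) : (P.facePolytopeIso F ⊥).1 = F := by
  have h := (P.facePolytopeIso F).le_symm_apply.1
    (bot_le (a := (P.facePolytopeIso F).symm ⟨F, (le_refl F : F ≤ F)⟩))
  exact le_antisymm h (P.facePolytopeIso F ⊥).2

/-- `P/F` is an arbitrary polytope realizing `[F, P]`, so its rank is only accessible through its
faces. A proper face of it realizes `[F, G]` with `G` proper, that is `G/F`, and induction applies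
to `G`. A facet of `P/F` then bounds its rank from above, and a facet of `P` containing `F` bounds
it from below. -/
lemma rank_facePolytope_aux : ∀ (n : ℕ) (P : Polytope) (F : P.L), P.rank = n →
    (P.facePolytope F).rank + P.faceRank F = P.rank := by
  intro n
  induction n using Nat.strong_induction_on with
  | _ n ih =>
    rintro P F rfl
    by_cases hF : F = ⊤
    · subst hF
      rw [rank, if_neg (by rw [RP.facePolytope_nonempty_iff]; simp), zero_add]
      rfl
    · have key : ∀ H : (P.facePolytope F).L, H ≠ ⊤ → ((P.facePolytope F).face H).rank +
          P.faceRank F = P.faceRank (P.facePolytopeIso F H).1 ∧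
          P.faceRank (P.facePolytopeIso F H).1 < P.rank := by
        intro H hH
        have hlt : P.faceRank (P.facePolytopeIso F H).1 < P.rank :=
          rank_face_lt fun h => hH ((P.facePolytopeIso F).injective
            (Subtype.ext (h.trans (P.facePolytopeIso_top F).symm)))
        refine ⟨?_, hlt⟩
        rw [rank_congr (face_facePolytope_equiv F H)]
        exact ih _ hlt _ _ rfl
      apply le_antisymm
      · obtain ⟨H, hH, hr⟩ := exists_facet ((RP.facePolytope_nonempty_iff P F).2 hF)
        have := key H hH
        omega
      · obtain ⟨G, hFG, hG, hr⟩ := exists_facet_ge hF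
        have hH : (P.facePolytopeIso F).symm ⟨G, hFG⟩ ≠ ⊤ := fun h => hG (by
          rw [← P.facePolytopeIso_top F, ← h, OrderIso.apply_symm_apply])
        have h1 := (key _ hH).1
        rw [OrderIso.apply_symm_apply] at h1
        have h2 := rank_face_lt hH
        change P.rank ≤ P.faceRank G + 1 at hr
        change _ = P.faceRank G at h1
        omega

/-- The face lattice is graded: `dim P/F = dim P - dim F - 1`. -/
lemma rank_facePolytope (P : Polytope) (F : P.L) :
    (P.facePolytope F).rank + P.faceRank F = P.rank :=
  rank_facePolytope_aux _ P F rfl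

/-- The interval `[F, G]` is realized by `G/F`, to which gradedness applies. So ranks in `P/F` are
ranks in `P` shifted by a constant, and the rank differences along a chain are the same in both. -/
lemma faceRank_facePolytope (P : Polytope) (F : P.L) (H : (P.facePolytope F).L) :
    (P.facePolytope F).faceRank H + P.faceRank F = P.faceRank (P.facePolytopeIso F H).1 := by
  rw [faceRank, rank_congr (face_facePolytope_equiv F H)]
  exact rank_facePolytope _ _

end Polytope

/-! ### Intervals of nonempty faces, and their behaviour under products -/

namespace NePolytope

lemma dim_eq_faceRank (P : NePolytope) (F : NeFace P.carrier) :
    (P.face F).dim + 1 = P.faceRank F.1 := (rank_of_nonempty F.2).symm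

lemma dim_eq_rank (P : NePolytope) : P.dim + 1 = P.rank := (rank_of_nonempty P.nonempty).symm

/-- The nonempty faces of a nonempty face `F` are the nonempty faces below `F`. -/
noncomputable def faceIso (P : NePolytope) (F : NeFace P.carrier) :
    NeFace (P.face F).carrier ≃o Set.Iic F where
  toFun G := ⟨⟨(P.toPolytope.faceIso F.1 G.1).1, G.2⟩, (P.toPolytope.faceIso F.1 G.1).2⟩
  invFun G := ⟨(P.toPolytope.faceIso F.1).symm ⟨G.1.1, G.2⟩, G.1.2⟩
  left_inv _ := rfl
  right_inv _ := rfl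
  map_rel_iff' := Iff.rfl

/-- The face lattice of `P/F` is the interval of nonempty faces above `F`. -/
noncomputable def facePolytopeIso (P : NePolytope) (F : NeFace P.carrier) :
    (P.facePolytope F).L ≃o Set.Ici F :=
  (P.toPolytope.facePolytopeIso F.1).trans
    -- Every face above a nonempty face is nonempty, so nothing of the interval is lost.
    { toFun := fun G => ⟨⟨G.1, F.2.mono G.2⟩, G.2⟩
      invFun := fun G => ⟨G.1.1, G.2⟩
      left_inv := fun _ => rfl
      right_inv := fun _ => rfl
      map_rel_iff' := Iff.rfl }

lemma face_prod_equiv {P Q : NePolytope}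
    (e : NeFace (P.prod Q).carrier ≃o NeFace P.carrier × NeFace Q.carrier)
    (K : NeFace (P.prod Q).carrier) :
    (P.prod Q).face K ≈ (P.face (e K).1).prod (Q.face (e K).2) :=
  equiv_of_neIso (((P.prod Q).faceIso K).trans ((iicIso e K).trans ((iicProd _ _).trans
    ((prodCongrIso (P.faceIso _) (Q.faceIso _)).symm.trans (exists_prodIso _ _).some.symm))))

/-- Here the direct product turns into the join. The interval above a pair of faces is a product of
two intervals, each of them a full face lattice with its own bottom; a product of full face lattices
belongs to the join, while a product of posets of nonempty faces belongs to the direct product. -/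
lemma facePolytope_prod_equiv {P Q : NePolytope}
    (e : NeFace (P.prod Q).carrier ≃o NeFace P.carrier × NeFace Q.carrier)
    (K : NeFace (P.prod Q).carrier) :
    (P.prod Q).facePolytope K ≈ (P.facePolytope (e K).1).join (Q.facePolytope (e K).2) :=
  ⟨((P.prod Q).facePolytopeIso K).trans ((iciIso e K).trans ((iciProd _ _).trans
    ((prodCongrIso (P.facePolytopeIso _) (Q.facePolytopeIso _)).symm.trans
      (exists_joinIso _ _).some.symm)))⟩

/-- Reindexing pairs of faces `∅ ≠ G ⊆ F ⊆ P`. -/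
noncomputable def flagEquiv (P : NePolytope) :
    (Σ F : NeFace P.carrier, NeFace (P.face F).carrier) ≃
      (Σ G : NeFace P.carrier, (P.facePolytope G).L) :=
  (Equiv.sigmaCongrRight fun F => (P.faceIso F).toEquiv).trans
    (Equiv.trans
      { toFun := fun x => ⟨x.2.1, x.1, x.2.2⟩
        invFun := fun x => ⟨x.2.1, x.1, x.2.2⟩
        left_inv := fun _ => rfl
        right_inv := fun _ => rfl }
      (Equiv.sigmaCongrRight fun G => (P.facePolytopeIso G).symm.toEquiv))

end NePolytope

/-! ### The comodule axioms and the grading -/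

namespace PolytopeRing

lemma hom_ext {M : Type*} [AddCommMonoid M] [Module ℤ M] {f g : PolytopeRing →ₗ[ℤ] M}
    (h : ∀ P, f (of P) = g (of P)) : f = g :=
  basis.ext fun c => by
    induction c using Quotient.inductionOn with
    | h P => exact h P

lemma of_mul (P Q : NePolytope) : of P * of Q = of (P.prod Q) := by
  have h := MonoidAlgebra.single_mul_single (R := ℤ) (M := NeCombPolytope) (Quotient.mk _ P)
    (Quotient.mk _ Q) 1 1
  rw [mul_one] at h
  exact h

lemma of_point : of NePolytope.point = 1 := rfl

lemma coaction_of (P : NePolytope) : coaction (of P) =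
    ∑ F : NeFace P.carrier, of (P.face F) ⊗ₜ[ℤ] RP.of (P.facePolytope F) := lift_of _ _ _

/-- Both sides run over nested pairs of nonempty faces of `P`. The left side chooses the larger face
first and then a face of it; the right side chooses the smaller face first and then a face of the
quotient by it. -/
lemma coaction_coassoc :
    (TensorProduct.assoc ℤ PolytopeRing RP RP).toLinearMap ∘ₗ coaction.rTensor RP ∘ₗ coaction =
      (Coalgebra.comul (R := ℤ) (A := RP)).lTensor PolytopeRing ∘ₗ coaction := by
  change _ = RP.comul.lTensor PolytopeRing ∘ₗ coaction
  refine hom_ext fun P => ?_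
  simp only [LinearMap.comp_apply, coaction_of, RP.comul_of, map_sum, LinearMap.rTensor_tmul,
    LinearMap.lTensor_tmul, TensorProduct.sum_tmul, TensorProduct.tmul_sum]
  rw [← Fintype.sum_sigma', ← Fintype.sum_sigma']
  refine Fintype.sum_equiv (NePolytope.flagEquiv P) _ _ ?_
  rintro ⟨F, G⟩
  have h1 : NePolytope.flagEquiv P ⟨F, G⟩ = ⟨(P.faceIso F G).1, (P.facePolytopeIso _).symm
    ⟨F, (P.faceIso F G).2⟩⟩ := rfl
  -- `H` is the larger face `F` seen as a face of the quotient of `P` by the smaller one. The three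
  -- equivalences below match the intervals `[∅, G]`, `[G, F]` and `[F, P]`.
  set H : (P.facePolytope (P.faceIso F G).1).L := (P.facePolytopeIso _).symm
    ⟨F, (P.faceIso F G).2⟩ with hH
  have hH' : P.facePolytopeIso (P.faceIso F G).1 H = ⟨F, (P.faceIso F G).2⟩ := by simp [hH]
  rw [h1]
  have e1 : (P.face F).face G ≈ P.face (P.faceIso F G).1 :=
    NePolytope.equiv_of_neIso (((P.face F).faceIso G).trans ((iicIso (P.faceIso F) G).trans
      ((iicIic _).trans (P.faceIso _).symm)))
  have e2 : (P.face F).facePolytope G ≈ (P.facePolytope (P.faceIso F G).1).face H := by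
    refine ⟨((P.face F).facePolytopeIso G).trans ((iciIso (P.faceIso F) G).trans
      ((iciIic _).trans (OrderIso.trans ?_ ((P.facePolytope _).faceIso H).symm)))⟩
    have := (iicIso (P.facePolytopeIso (P.faceIso F G).1) H).trans (iicIci _)
    rw [hH'] at this
    exact this.symm
  have e3 : P.facePolytope F ≈ (P.facePolytope (P.faceIso F G).1).facePolytope H := by
    refine ⟨(P.facePolytopeIso F).trans (OrderIso.trans ?_
      ((P.facePolytope _).facePolytopeIso H).symm)⟩
    have := (iciIso (P.facePolytopeIso (P.faceIso F G).1) H).trans (iciIci _)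
    rw [hH'] at this
    exact this.symm
  change of _ ⊗ₜ[ℤ] (RP.of _ ⊗ₜ[ℤ] RP.of _) = _
  rw [of_congr e1, RP.of_congr e2, RP.of_congr e3]

/-- The largest nonempty face. -/
def topFace (P : NePolytope) : NeFace P.carrier := ⟨⊤, P.nonempty⟩

/-- Only the term `F = P` survives, since every other `P/F` is nonempty. -/
lemma coaction_counit : (Coalgebra.counit (R := ℤ) (A := RP)).lTensor PolytopeRing ∘ₗ coaction =
    (TensorProduct.mk ℤ PolytopeRing ℤ).flip 1 := by
  change RP.counit.lTensor PolytopeRing ∘ₗ coaction = _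
  refine hom_ext fun P => ?_
  have hne : ∀ F : NeFace P.carrier, F ≠ topFace P →
      (P.facePolytope F).carrier.Nonempty := fun F hF =>
    (RP.facePolytope_nonempty_iff _ _).2 fun h => hF (Subtype.ext h)
  have htop : ¬ (P.facePolytope (topFace P)).carrier.Nonempty := fun h =>
    (RP.facePolytope_nonempty_iff _ _).1 h rfl
  simp only [LinearMap.comp_apply, coaction_of, map_sum, LinearMap.lTensor_tmul, RP.counit_of]
  rw [Finset.sum_eq_single (topFace P) (fun F _ hF => by simp [hne F hF]) (by simp), if_neg htop]
  rfl

lemma coaction_one : coaction 1 = 1 := by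
  rw [← of_point, coaction_of]
  have : Unique (NeFace NePolytope.point.carrier) := instUniquePoint
  rw [Fintype.sum_subsingleton _ (topFace NePolytope.point)]
  -- The quotient of the point by itself has a one-element face lattice, so it is the empty
  -- polytope, the unit for the join.
  have h2 : NePolytope.point.facePolytope (topFace NePolytope.point) ≈ Polytope.empty := by
    refine ⟨(NePolytope.point.facePolytopeIso _).trans ?_⟩
    have : Unique (Set.Ici (topFace NePolytope.point)) :=
      ⟨⟨⟨_, le_refl (topFace NePolytope.point)⟩⟩, fun _ => Subtype.ext (Subsingleton.elim _ _)⟩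
    exact OrderIso.ofUnique _ _
  rw [RP.of_congr h2]
  rfl

lemma coaction_mul (x y : PolytopeRing) : coaction (x * y) = coaction x * coaction y := by
  -- Both sides are bilinear, so basis elements suffice; there the pairs of nonempty faces of the
  -- factors index the terms on either side.
  have : (LinearMap.mul ℤ PolytopeRing).compr₂ coaction =
      (LinearMap.mul ℤ (PolytopeRing ⊗[ℤ] RP)).compl₁₂ coaction coaction := by
    refine hom_ext fun P => hom_ext fun Q => ?_
    change coaction (of P * of Q) = coaction (of P) * coaction (of Q)
    obtain ⟨e⟩ : Nonempty (NeFace (P.prod Q).carrier ≃o NeFace P.carrier × NeFace Q.carrier) :=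
      exists_prodIso P.toPolytope Q.toPolytope
    rw [of_mul, coaction_of, coaction_of, coaction_of, Finset.sum_mul_sum,
      ← Fintype.sum_prod_type']
    refine Fintype.sum_equiv e.toEquiv _ _ fun K => ?_
    rw [Algebra.TensorProduct.tmul_mul_tmul, of_mul, RP.of_mul,
      of_congr (NePolytope.face_prod_equiv e K), RP.of_congr (NePolytope.facePolytope_prod_equiv e K)]
    rfl
  exact DFunLike.congr_fun (DFunLike.congr_fun this x) y

lemma isRightHopfComodule_coaction : IsRightHopfComodule ℤ RP PolytopeRing coaction where
  coassoc := coaction_coassoc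
  counit := coaction_counit
  map_one := coaction_one
  map_mul := coaction_mul

/-- The degree in `ℛ𝒫` counts `dim + 1`, which absorbs the `-1` in `dim P/F = dim P - dim F - 1`. -/
lemma dim_add_rank_facePolytope (P : NePolytope) (F : NeFace P.carrier) :
    (P.face F).dim + (P.facePolytope F).rank = P.dim := by
  have h1 : (P.facePolytope F).rank + _ = _ := rank_facePolytope P.toPolytope F.1
  have h2 := P.dim_eq_faceRank F
  have h3 := P.dim_eq_rank
  omega

lemma coaction_mem_tensorGrading (n : ℕ) (x : PolytopeRing) (hx : x ∈ grading n) :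
    coaction x ∈ tensorGrading n := by
  induction hx using Submodule.span_induction with
  | mem x hx =>
    obtain ⟨P, rfl, rfl⟩ := hx
    rw [coaction_of]
    refine Submodule.sum_mem _ fun F _ => ?_
    refine Submodule.mem_iSup_of_mem ((P.face F).dim, (P.facePolytope F).rank)
      (Submodule.mem_iSup_of_mem ?_ ?_)
    · exact Finset.HasAntidiagonal.mem_antidiagonal.2 (dim_add_rank_facePolytope P F)
    · exact ⟨⟨of (P.face F), Submodule.subset_span ⟨_, rfl, rfl⟩⟩ ⊗ₜ
        ⟨RP.of (P.facePolytope F), Submodule.subset_span ⟨_, rfl, rfl⟩⟩, by simp⟩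
  | zero => rw [map_zero]; exact Submodule.zero_mem _
  | add x y _ _ hx hy => rw [map_add]; exact Submodule.add_mem _ hx hy
  | smul a x _ hx => rw [map_smul]; exact Submodule.smul_mem _ _ hx

end PolytopeRing

/-! ### Successive differences of a finite set of integers -/

section Gaps

lemma gaps_singleton (a : ℕ) : gaps {a} = [] := by simp [gaps]

/-- Translation invariance allows ranks in place of dimensions, and ranks in `P` in place of ranks
in `P/F`. -/
lemma gaps_image_add (S : Finset ℕ) (c : ℕ) : gaps (S.image (· + c)) = gaps S := by
  have h : (S.image (· + c)).sort (· ≤ ·) = (S.sort (· ≤ ·)).map (· + c) := by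
    have := Finset.map_sort (r := (· ≤ ·)) (r' := (· ≤ ·)) (addRightEmbedding c) S
      (fun a _ b _ => by simp)
    rw [Finset.map_eq_image] at this
    exact this.symm
  rw [gaps, gaps, h, ← List.map_tail, List.zipWith_map]
  congr 1
  funext a b
  omega

/-- A new minimum affects only the head of the sorted list. This drives every recursion in which a
chain grows at its bottom. -/
lemma gaps_insert {a b : ℕ} {S : Finset ℕ} (hb : b ∈ S) (hmin : ∀ x ∈ S, b ≤ x) (hab : a < b) :
    gaps (insert a S) = (b - a) :: gaps S := by
  have ha : ∀ x ∈ S, a < x := fun x hx => hab.trans_le (hmin x hx)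
  obtain ⟨T, hT, rfl⟩ : ∃ T, b ∉ T ∧ insert b T = S :=
    ⟨S.erase b, by simp, Finset.insert_erase hb⟩
  rw [gaps, gaps, Finset.sort_insert _ (fun x hx => (ha x hx).le) fun h => (ha a h).false,
    Finset.sort_insert _ (fun x hx => hmin x (Finset.mem_insert_of_mem hx)) hT]
  simp

/-- The differences telescope, by induction on the number of elements with the minimum removed. So
the gaps form a composition of `b - a`. -/
lemma gaps_sum_and_pos (n : ℕ) : ∀ (S : Finset ℕ) (a b : ℕ), S.card = n → a ∈ S → b ∈ S →
    (∀ x ∈ S, a ≤ x) → (∀ x ∈ S, x ≤ b) → (gaps S).sum + a = b ∧ ∀ j ∈ gaps S, 0 < j := by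
  induction n with
  | zero =>
    intro S a b h ha
    rw [Finset.card_eq_zero] at h
    simp [h] at ha
  | succ n ih =>
    intro S a b h ha hb hmin hmax
    by_cases hS : (S.erase a).Nonempty
    · have hc := (S.erase a).min'_mem hS
      set c := (S.erase a).min' hS
      have hac : a < c := lt_of_le_of_ne (hmin c (Finset.mem_of_mem_erase hc))
        (Finset.ne_of_mem_erase hc).symm
      have hbS : b ∈ S.erase a := Finset.mem_erase.2
        ⟨(hac.trans_le (hmax c (Finset.mem_of_mem_erase hc))).ne', hb⟩
      have hcmin : ∀ x ∈ S.erase a, c ≤ x := fun x hx => Finset.min'_le _ x hx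
      obtain ⟨h1, h2⟩ := ih (S.erase a) c b (by rw [Finset.card_erase_of_mem ha]; omega) hc hbS
        hcmin fun x hx => hmax x (Finset.mem_of_mem_erase hx)
      rw [← Finset.insert_erase ha, gaps_insert hc hcmin hac]
      refine ⟨by rw [List.sum_cons]; omega, fun j hj => ?_⟩
      rcases List.mem_cons.1 hj with rfl | hj
      · omega
      · exact h2 j hj
    · have hS' : S = {a} := by
        rw [← Finset.insert_erase ha, Finset.not_nonempty_iff_eq_empty.1 hS]
        rfl
      subst hS'
      rw [gaps_singleton]
      simpa using (Finset.mem_singleton.1 hb).symm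

end Gaps

/-! ### Chains of faces ending at the polytope -/

namespace Polytope

lemma faceRank_strictMono (P : Polytope) : StrictMono P.faceRank := by
  intro F G h
  refine rank_face_lt (P := P.face G) (F := (P.faceIso G).symm ⟨F, h.le⟩) fun hc => h.ne ?_
  have := congrArg (fun z => ((P.faceIso G) z).1) hc
  simpa using this

lemma faceRank_top (P : Polytope) : P.faceRank ⊤ = P.rank := rfl

lemma faceRank_bot (P : Polytope) : P.faceRank ⊥ = 0 := if_neg (by
  change ¬ (∅ : Set (Fin P.ambient → ℝ)).Nonempty
  simp)

open Classical in
/-- The chains of faces of `P` with least element `F` and greatest element `P`. -/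
noncomputable def chainsFrom (P : Polytope) (F : P.L) : Finset (Finset P.L) :=
  Finset.univ.filter fun s => IsChain (· ≤ ·) (s : Set P.L) ∧ F ∈ s ∧ ⊤ ∈ s ∧ ∀ x ∈ s, F ≤ x

lemma mem_chainsFrom {P : Polytope} {F : P.L} {s : Finset P.L} : s ∈ P.chainsFrom F ↔
    IsChain (· ≤ ·) (s : Set P.L) ∧ F ∈ s ∧ ⊤ ∈ s ∧ ∀ x ∈ s, F ≤ x := by
  simp [chainsFrom]

/-- A minimal element of a chain is its least element. With `eq_of_mem_chainsFrom`, the chains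
through `P` are partitioned by their least face. -/
lemma exists_mem_chainsFrom {P : Polytope} {s : Finset P.L} (hs : IsChain (· ≤ ·) (s : Set P.L))
    (ht : ⊤ ∈ s) : ∃ F, s ∈ P.chainsFrom F := by
  obtain ⟨F, hF⟩ := s.exists_minimal ⟨⊤, ht⟩
  refine ⟨F, mem_chainsFrom.2 ⟨hs, hF.1, ht, fun x hx => ?_⟩⟩
  rcases hs.total hF.1 hx with h | h
  · exact h
  · exact hF.2 hx h

lemma eq_of_mem_chainsFrom {P : Polytope} {s : Finset P.L} {F G : P.L} (hF : s ∈ P.chainsFrom F)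
    (hG : s ∈ P.chainsFrom G) : F = G := by
  rw [mem_chainsFrom] at hF hG
  exact le_antisymm (hF.2.2.2 _ hG.2.1) (hG.2.2.2 _ hF.2.1)

/-- The composition attached to a chain of faces. -/
noncomputable def chainType (P : Polytope) (s : Finset P.L) : List ℕ := gaps (s.image P.faceRank)

/-- The lattice of `P/F` embeds in `L(P)` as `[F, P]`, carrying chains from bottom to top to chains
from `F` to `P`. From here on all sums live in the single lattice `L(P)`. -/
lemma ehrenborg_facePolytope (P : Polytope) (F : P.L) : ehrenborg (RP.of (P.facePolytope F)) =
    ∑ s ∈ P.chainsFrom F, Qsym.monomial (P.chainType s) := by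
  classical
  let i : (P.facePolytope F).L ↪ P.L :=
    (P.facePolytopeIso F).toEquiv.toEmbedding.trans (Function.Embedding.subtype _)
  have hi : ∀ H, i H = (P.facePolytopeIso F H).1 := fun _ => rfl
  have hle : ∀ H K, i H ≤ i K ↔ H ≤ K := fun H K => (P.facePolytopeIso F).le_iff_le
  have hbot : i ⊥ = F := P.facePolytopeIso_bot F
  have htop : i ⊤ = ⊤ := P.facePolytopeIso_top F
  have hsurj : ∀ G, F ≤ G → ∃ H, i H = G := fun G hG =>
    ⟨(P.facePolytopeIso F).symm ⟨G, hG⟩, by simp [hi]⟩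
  rw [ehrenborg, RP.lift_of]
  refine Finset.sum_nbij (fun s => s.map i) ?_ ?_ ?_ ?_
  · intro s hs
    obtain ⟨h1, h2, h3⟩ := (Finset.mem_filter.1 hs).2
    refine mem_chainsFrom.2 ⟨?_, ?_, ?_, ?_⟩
    · rw [Finset.coe_map]
      rintro _ ⟨x, hx, rfl⟩ _ ⟨y, hy, rfl⟩ hxy
      simpa only [hle] using h1 hx hy fun hc => hxy (by rw [hc])
    · exact Finset.mem_map.2 ⟨_, h2, hbot⟩
    · exact Finset.mem_map.2 ⟨_, h3, htop⟩
    · intro x hx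
      obtain ⟨y, -, rfl⟩ := Finset.mem_map.1 hx
      exact (P.facePolytopeIso F y).2
  · exact (Finset.map_injective i).injOn
  · intro s hs
    obtain ⟨h1, h2, h3, h4⟩ := mem_chainsFrom.1 hs
    refine ⟨Finset.univ.filter fun H => i H ∈ s, ?_, ?_⟩
    · refine Finset.mem_coe.2 (Finset.mem_filter.2 ⟨Finset.mem_univ _, ?_, ?_, ?_⟩)
      · intro x hx y hy hxy
        simp only [Finset.coe_filter, Finset.mem_univ, true_and, Set.mem_ofPred_eq] at hx hy
        simpa only [hle] using h1 hx hy (i.injective.ne hxy)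
      · simpa [hbot] using h2
      · simpa [htop] using h3
    · ext G
      rw [Finset.mem_map]
      constructor
      · rintro ⟨H, hH, rfl⟩
        exact (Finset.mem_filter.1 hH).2
      · intro hG
        obtain ⟨H, rfl⟩ := hsurj G (h4 G hG)
        exact ⟨H, by simpa using hG, rfl⟩
  · intro s _
    -- By gradedness the ranks in `P/F`, shifted by the rank of `F`, are the ranks in `P`.
    rw [chainType, ← gaps_image_add (s.image _) (P.faceRank F), Finset.image_image,
      Finset.map_eq_image, Finset.image_image]
    congr 2
    refine Finset.image_congr fun H _ => ?_
    exact faceRank_facePolytope P F H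

/-- The type of a chain from `F` is thus a composition of `dim P - dim F` when `F` is nonempty, and
so lies in the range of the sum defining `coactionL`. -/
lemma chainType_sum_and_pos {P : Polytope} {F : P.L} {s : Finset P.L} (hs : s ∈ P.chainsFrom F) :
    (P.chainType s).sum + P.faceRank F = P.rank ∧ ∀ j ∈ P.chainType s, 0 < j := by
  obtain ⟨h1, h2, h3, h4⟩ := mem_chainsFrom.1 hs
  refine gaps_sum_and_pos _ _ _ _ rfl (Finset.mem_image_of_mem _ h2)
    (Finset.mem_image_of_mem P.faceRank h3) ?_ ?_
  · simp only [Finset.forall_mem_image]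
    exact fun x hx => P.faceRank_strictMono.monotone (h4 x hx)
  · simp only [Finset.forall_mem_image]
    exact fun x _ => P.faceRank_strictMono.monotone le_top

open Classical in
lemma insert_mem_chainsFrom {P : Polytope} {F G : P.L} {s : Finset P.L} (hs : s ∈ P.chainsFrom F)
    (hG : G ≤ F) : insert G s ∈ P.chainsFrom G := by
  obtain ⟨h1, h2, h3, h4⟩ := mem_chainsFrom.1 hs
  refine mem_chainsFrom.2 ⟨?_, Finset.mem_insert_self _ _, Finset.mem_insert_of_mem h3, ?_⟩
  · rw [Finset.coe_insert]
    exact h1.insert fun b hb _ => Or.inl (hG.trans (h4 b hb))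
  · intro x hx
    rcases Finset.mem_insert.1 hx with rfl | hx
    · exact le_rfl
    · exact hG.trans (h4 x hx)

open Classical in
lemma chainType_insert {P : Polytope} {F G : P.L} {s : Finset P.L} (hs : s ∈ P.chainsFrom F)
    (hG : G < F) :
    P.chainType (insert G s) = (P.faceRank F - P.faceRank G) :: P.chainType s := by
  obtain ⟨h1, h2, h3, h4⟩ := mem_chainsFrom.1 hs
  rw [chainType, Finset.image_insert]
  refine gaps_insert (Finset.mem_image_of_mem _ h2) ?_ (P.faceRank_strictMono hG)
  simp only [Finset.forall_mem_image]
  exact fun x hx => P.faceRank_strictMono.monotone (h4 x hx)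

lemma singleton_top_mem_chainsFrom (P : Polytope) : {⊤} ∈ P.chainsFrom ⊤ :=
  mem_chainsFrom.2 (by simp)

-- This reverses `insert_mem_chainsFrom`: a chain other than `{P}` arises in one way by adding its
-- least face to a shorter chain. It is the recursion used for `dWord_of`.
open Classical in
lemma mem_chainsFrom_cases {P : Polytope} {G : P.L} {s : Finset P.L} (hs : s ∈ P.chainsFrom G) :
    (G = ⊤ ∧ s = {⊤}) ∨ ∃ F, G < F ∧ s.erase G ∈ P.chainsFrom F ∧ insert G (s.erase G) = s := by
  obtain ⟨h1, h2, h3, h4⟩ := mem_chainsFrom.1 hs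
  by_cases hG : G = ⊤
  · subst hG
    refine Or.inl ⟨rfl, Finset.eq_singleton_iff_unique_mem.2 ⟨h2, fun x hx => ?_⟩⟩
    exact top_le_iff.1 (h4 x hx)
  · obtain ⟨F, hF⟩ := exists_mem_chainsFrom (s := s.erase G)
      (h1.mono (Finset.coe_subset.2 (Finset.erase_subset _ _)))
      (Finset.mem_erase.2 ⟨fun h => hG h.symm, h3⟩)
    have hF' := Finset.mem_erase.1 (mem_chainsFrom.1 hF).2.1
    exact Or.inr ⟨F, lt_of_le_of_ne (h4 F hF'.2) hF'.1.symm, hF, Finset.insert_erase h2⟩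

end Polytope

/-! ### Face operators and the coaction on quasi-symmetric functions -/

namespace PolytopeRing

lemma d_of (k : ℕ) (P : NePolytope) : d k (of P) =
    ∑ F : NeFace P.carrier with (P.face F).dim + k = P.dim, of (P.face F) := lift_of _ _ _

-- Faces of `F` are faces of `P` below `F`, so iterated face operators can be computed inside
-- `L(P)`.
open Classical in
lemma d_of_face (k : ℕ) (P : NePolytope) (F : NeFace P.carrier) : d k (of (P.face F)) =
    ∑ G : NeFace P.carrier with G ≤ F ∧ P.faceRank G.1 + k = P.faceRank F.1, of (P.face G) := by
  rw [d_of]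
  have hdim : ∀ G : NeFace (P.face F).carrier,
      ((P.face F).face G).dim + 1 = P.faceRank (P.faceIso F G).1.1 := fun G =>
    P.dim_eq_faceRank (P.faceIso F G).1
  have hF := P.dim_eq_faceRank F
  refine Finset.sum_nbij (fun G => (P.faceIso F G).1) ?_ ?_ ?_ ?_
  · intro G hG
    have h1 := (Finset.mem_filter.1 hG).2
    have h2 := hdim G
    exact Finset.mem_filter.2 ⟨Finset.mem_univ _, (P.faceIso F G).2, by omega⟩
  · exact (Subtype.val_injective.comp (P.faceIso F).injective).injOn
  · intro G hG
    obtain ⟨h1, h2⟩ := (Finset.mem_filter.1 (Finset.mem_coe.1 hG)).2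
    refine ⟨(P.faceIso F).symm ⟨G, h1⟩, Finset.mem_coe.2 (Finset.mem_filter.2
      ⟨Finset.mem_univ _, ?_⟩), by simp⟩
    have h3 := hdim ((P.faceIso F).symm ⟨G, h1⟩)
    rw [OrderIso.apply_symm_apply] at h3
    change _ = P.faceRank G.1 at h3
    omega
  · intro G _
    rfl

-- Induction on the word. The leftmost operator acts last and adds a new least face at the bottom of
-- the chain, so the gaps read upwards spell `ω`. Positivity of the letters makes each step strict;
-- `d 0` would repeat a face instead.
open Classical in
lemma dWord_of (P : NePolytope) (ω : List ℕ) (hω : ∀ j ∈ ω, 0 < j) : dWord ω (of P) =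
    ∑ F : NeFace P.carrier, ∑ s ∈ P.chainsFrom F.1 with P.chainType s = ω, of (P.face F) := by
  induction ω with
  | nil =>
    rw [Finset.sum_eq_single (topFace P)]
    · have h : (P.chainsFrom (topFace P).1).filter (fun s => P.chainType s = []) = {{⊤}} := by
        refine Finset.eq_singleton_iff_unique_mem.2 ⟨Finset.mem_filter.2
          ⟨P.singleton_top_mem_chainsFrom, ?_⟩, fun s hs => ?_⟩
        · rw [chainType, Finset.image_singleton, gaps_singleton]
        · rcases mem_chainsFrom_cases (Finset.mem_filter.1 hs).1 with h | ⟨F, h, -⟩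
          · exact h.2
          · exact absurd h not_top_lt
      rw [h, Finset.sum_singleton]
      rfl
    · intro F _ hF
      refine Finset.sum_eq_zero fun s hs => ?_
      obtain ⟨h1, h2⟩ := Finset.mem_filter.1 hs
      rcases mem_chainsFrom_cases h1 with h | ⟨F', h3, h4, h5⟩
      · exact absurd (Subtype.ext h.1) hF
      · rw [← h5, chainType_insert h4 h3] at h2
        exact absurd h2 (List.cons_ne_nil _ _)
    · simp
  | cons j ω ih =>
    have hj : 0 < j := hω j (by simp)
    change d j (dWord ω (of P)) = _
    rw [ih fun i hi => hω i (by simp [hi])]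
    simp only [map_sum, d_of_face]
    -- The new least face `G` must become the outer index, so its conditions are moved into the
    -- filter on chains.
    have comm : ∀ F : NeFace P.carrier,
        (∑ s ∈ P.chainsFrom F.1 with P.chainType s = ω, ∑ G : NeFace P.carrier with
          G ≤ F ∧ P.faceRank G.1 + j = P.faceRank F.1, of (P.face G)) =
        ∑ G : NeFace P.carrier, ∑ s ∈ P.chainsFrom F.1 with P.chainType s = ω ∧
          G ≤ F ∧ P.faceRank G.1 + j = P.faceRank F.1, of (P.face G) := by
      intro F
      simp only [Finset.sum_filter, ite_and]
      rw [Finset.sum_comm]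
      refine Finset.sum_congr rfl fun s _ => ?_
      split_ifs <;> simp
    simp only [comm]
    rw [Finset.sum_comm]
    refine Finset.sum_congr rfl fun G _ => ?_
    rw [Finset.sum_sigma']
    -- For fixed `G`, a pair `(F, s)` corresponds to the chain with `G` put below `s`; the face `F`
    -- is recovered as the least element of `s`.
    refine Finset.sum_bij (fun x _ => insert G.1 x.2) ?_ ?_ ?_ fun _ _ => rfl
    · rintro ⟨F, s⟩ hs
      obtain ⟨h1, h2, h3, h4⟩ : s ∈ P.chainsFrom F.1 ∧ P.chainType s = ω ∧ G ≤ F ∧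
        P.faceRank G.1 + j = P.faceRank F.1 := by simpa using hs
      have hlt : G.1 < F.1 := lt_of_le_of_ne h3 fun h => by rw [h] at h4; omega
      refine Finset.mem_filter.2 ⟨insert_mem_chainsFrom h1 hlt.le, ?_⟩
      rw [chainType_insert h1 hlt, h2, ← h4, Nat.add_sub_cancel_left]
    · rintro ⟨F, s⟩ hs ⟨F', s'⟩ hs' h
      obtain ⟨h1, h2, h3, h4⟩ : s ∈ P.chainsFrom F.1 ∧ P.chainType s = ω ∧ G ≤ F ∧
        P.faceRank G.1 + j = P.faceRank F.1 := by simpa using hs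
      obtain ⟨h1', h2', h3', h4'⟩ : s' ∈ P.chainsFrom F'.1 ∧ P.chainType s' = ω ∧ G ≤ F' ∧
        P.faceRank G.1 + j = P.faceRank F'.1 := by simpa using hs'
      -- `G` lies below the least element `F` of `s`, so membership would force `G = F`, against `j
      -- > 0`. Hence erasing `G` undoes the insertion.
      have hG : G.1 ∉ s := fun hc => by
        rw [le_antisymm h3 ((mem_chainsFrom.1 h1).2.2.2 _ hc)] at h4
        omega
      have hG' : G.1 ∉ s' := fun hc => by
        rw [le_antisymm h3' ((mem_chainsFrom.1 h1').2.2.2 _ hc)] at h4'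
        omega
      obtain rfl : s = s' := by
        rw [← Finset.erase_insert hG, ← Finset.erase_insert hG']
        exact congrArg (fun t => t.erase G.1) h
      obtain rfl : F = F' := Subtype.ext (eq_of_mem_chainsFrom h1 h1')
      rfl
    · intro s hs
      obtain ⟨h1, h2⟩ := Finset.mem_filter.1 hs
      rcases mem_chainsFrom_cases h1 with ⟨-, rfl⟩ | ⟨F, h3, h4, h5⟩
      · rw [chainType, Finset.image_singleton, gaps_singleton] at h2
        exact absurd h2.symm (List.cons_ne_nil _ _)
      · rw [← h5, chainType_insert h4 h3, List.cons.injEq] at h2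
        have := P.faceRank_strictMono h3
        refine ⟨⟨⟨F, G.2.mono h3.le⟩, s.erase G.1⟩, ?_, h5⟩
        simp only [Finset.mem_sigma, Finset.mem_univ, Finset.mem_filter, true_and]
        exact ⟨h4, h2.2, h3.le, by omega⟩

lemma lTensor_ehrenborg_coaction_of (P : NePolytope) :
    ehrenborg.lTensor PolytopeRing (coaction (of P)) =
      ∑ F : NeFace P.carrier, ∑ s ∈ P.chainsFrom F.1,
        of (P.face F) ⊗ₜ[ℤ] Qsym.monomial (P.chainType s) := by
  rw [coaction_of, map_sum]
  refine Finset.sum_congr rfl fun F _ => ?_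
  rw [LinearMap.lTensor_tmul, ← TensorProduct.tmul_sum]
  exact congrArg _ (ehrenborg_facePolytope P.toPolytope F.1)

/-- Grouping the pairs (nonempty face, chain above it) by chain type produces the sum over
compositions. -/
lemma lTensor_ehrenborg_coaction :
    ehrenborg.lTensor PolytopeRing ∘ₗ coaction = coactionL := by
  classical
  refine hom_ext fun P => ?_
  rw [LinearMap.comp_apply, lTensor_ehrenborg_coaction_of, coactionL, lift_of]
  symm
  rw [Finset.sum_sigma']
  have key : ∀ x ∈ (Finset.range (P.dim + 1)).sigma
      (fun n => (Finset.univ : Finset (Composition n))),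
      dWord x.2.blocks (of P) ⊗ₜ[ℤ] Qsym.monomial x.2.blocks =
        ∑ F : NeFace P.carrier, ∑ s ∈ P.chainsFrom F.1, if P.chainType s = x.2.blocks then
          of (P.face F) ⊗ₜ[ℤ] Qsym.monomial (P.chainType s) else 0 := by
    intro x _
    rw [dWord_of P _ fun j hj => x.2.blocks_pos hj, TensorProduct.sum_tmul]
    refine Finset.sum_congr rfl fun F _ => ?_
    rw [TensorProduct.sum_tmul, ← Finset.sum_filter]
    exact Finset.sum_congr rfl fun s hs => by rw [(Finset.mem_filter.1 hs).2]
  rw [Finset.sum_congr rfl key, Finset.sum_comm]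
  refine Finset.sum_congr rfl fun F _ => ?_
  rw [Finset.sum_comm]
  refine Finset.sum_congr rfl fun s hs => ?_
  obtain ⟨h1, h2⟩ := chainType_sum_and_pos hs
  -- Each chain meets exactly one composition, the one whose blocks are its type.
  rw [Finset.sum_eq_single ⟨(P.chainType s).sum, P.chainType s, fun {j} hj => h2 j hj, rfl⟩]
  · rw [if_pos rfl]
  · intro x _ hx
    rw [if_neg fun h => hx ?_]
    exact Composition.sigma_eq_iff_blocks_eq.2 h.symm
  · intro h
    refine absurd (Finset.mem_sigma.2 ⟨Finset.mem_range.2 ?_, Finset.mem_univ _⟩) h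
    have h3 := P.dim_eq_faceRank F
    have h4 := P.dim_eq_rank
    change (P.chainType s).sum < _
    omega

/-! ### The generalized `f`-polynomial -/

open Polynomial in
/-- The coefficientwise extension of `F*` is additive. -/
noncomputable def ehrenborgStarPolyHom : RP[X] →+ Qsym[X] where
  toFun := ehrenborgStarPoly
  map_zero' := by simp [ehrenborgStarPoly]
  map_add' p q := Polynomial.sum_add_index _ _ _ (by simp) (by simp)

lemma ehrenborgStarPoly_monomial (n : ℕ) (a : RP) :
    ehrenborgStarPoly (Polynomial.monomial n a) = Polynomial.monomial n (ehrenborgStar a) :=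
  Polynomial.sum_monomial_index _ _ (by simp)

lemma ehrenborgStarPoly_lAlpha_of (P : NePolytope) : ehrenborgStarPoly (lAlpha (of P)) =
    ∑ F : NeFace P.carrier, ∑ s ∈ P.chainsFrom F.1,
      Polynomial.monomial (P.face F).dim (Qsym.monomial (P.chainType s).reverse) := by
  change ehrenborgStarPolyHom _ = _
  rw [lAlpha, lift_of, map_sum]
  refine Finset.sum_congr rfl fun F _ => ?_
  change ehrenborgStarPoly _ = _
  have h : ehrenborg (RP.of (P.facePolytope F)) = _ := ehrenborg_facePolytope P.toPolytope F.1
  rw [ehrenborgStarPoly_monomial, ehrenborgStar, LinearMap.comp_apply, h, map_sum, map_sum]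
  -- The involution reverses each type, giving the order `(n - a_k, …, a₂ - a₁)` used by `f`.
  simp only [Qsym.star_monomial]

-- The flag number is unrolled into one term per chain, ready for a bijection.
open Classical in
lemma fPolynomial_of (P : NePolytope) : fPolynomial (of P) =
    ∑ S ∈ (Finset.range P.dim).powerset, ∑ _s ∈ Finset.univ.filter fun s : Finset P.L =>
      IsChain (· ≤ ·) (s : Set P.L) ∧ s.image P.faceRank = S.image (· + 1),
      Polynomial.monomial ((insert P.dim S).min' (Finset.insert_nonempty _ _))
        (Qsym.monomial (gaps (insert P.dim S)).reverse) := by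
  rw [fPolynomial, lift_of]
  refine Finset.sum_congr rfl fun S _ => ?_
  rw [Finset.sum_const, flagNumber]

/-- Rank increases along a chain, so the least rank belongs to the least face. It identifies the
exponent of `α`, also for the chain `{P}`, whose exponent is `dim P`. -/
lemma min'_of_image_add_one {S : Finset ℕ} (hS : S.Nonempty) {P : Polytope} {F : P.L}
    {s : Finset P.L} (hs : s ∈ P.chainsFrom F) (h : S.image (· + 1) = s.image P.faceRank) :
    S.min' hS + 1 = P.faceRank F := by
  obtain ⟨-, h2, -, h4⟩ := mem_chainsFrom.1 hs
  apply le_antisymm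
  · have := h ▸ Finset.mem_image_of_mem P.faceRank h2
    obtain ⟨a, ha, hF⟩ := Finset.mem_image.1 this
    rw [← hF]
    exact Nat.succ_le_succ (Finset.min'_le _ _ ha)
  · have := h ▸ Finset.mem_image_of_mem (· + 1) (S.min'_mem hS)
    obtain ⟨G, hG, hF⟩ := Finset.mem_image.1 this
    rw [← hF]
    exact P.faceRank_strictMono.monotone (h4 G hG)

-- Deleting `P` from a chain that starts at a nonempty face gives a flag of nonempty proper faces,
-- with dimensions in `{0, …, n-1}`; adding `P` back is the inverse.
open Classical in
lemma ehrenborgStarPoly_lAlpha (x : PolytopeRing) :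
    ehrenborgStarPoly (lAlpha x) = fPolynomial x := by
  suffices h : ehrenborgStarPolyHom.toIntLinearMap ∘ₗ lAlpha = fPolynomial from
    DFunLike.congr_fun h x
  refine hom_ext fun P => ?_
  change ehrenborgStarPoly (lAlpha (of P)) = _
  rw [ehrenborgStarPoly_lAlpha_of, fPolynomial_of, Finset.sum_sigma', Finset.sum_sigma']
  have hdim := P.dim_eq_rank
  -- Nonempty faces have rank at least one, so the truncated subtraction from rank to dimension
  -- loses nothing.
  have himage : ∀ s : Finset P.L, ⊥ ∉ s → ((s.image P.faceRank).image (· - 1)).image (· + 1) =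
      s.image P.faceRank := by
    intro s hs
    rw [Finset.image_image]
    conv_rhs => rw [← Finset.image_id (s := s.image P.faceRank)]
    refine Finset.image_congr fun a ha => ?_
    obtain ⟨G, hG, rfl⟩ := Finset.mem_image.1 (Finset.mem_coe.1 ha)
    have : P.faceRank ⊥ < P.faceRank G :=
      P.faceRank_strictMono (bot_lt_iff_ne_bot.2 fun h => hs (h ▸ hG))
    simp only [Function.comp_apply, id_eq]
    omega
  -- Putting `P` back into the flag adds its dimension `n` to the set; this explains `insert P.dim
  -- S` in `fPolynomial`.
  have himage_insert : ∀ (S : Finset ℕ) (s : Finset P.L), ⊤ ∈ s →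
      S.image (· + 1) = (s.erase ⊤).image P.faceRank →
      (insert P.dim S).image (· + 1) = s.image P.faceRank := by
    intro S s ht h
    rw [Finset.image_insert, h, hdim, ← faceRank_top, ← Finset.image_insert,
      Finset.insert_erase ht]
  have hbot : ∀ (F : NeFace P.carrier) (s : Finset P.L), s ∈ P.chainsFrom F.1 → ⊥ ∉ s := by
    intro F s hs hc
    have := (mem_chainsFrom.1 hs).2.2.2 _ hc
    exact Set.not_nonempty_empty (F.2.mono this)
  refine Finset.sum_bij (fun x _ =>
    ⟨((x.2.erase ⊤).image P.faceRank).image (· - 1), x.2.erase ⊤⟩) ?_ ?_ ?_ ?_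
  · rintro ⟨F, s⟩ hs
    have hs : s ∈ P.chainsFrom F.1 := (Finset.mem_sigma.1 hs).2
    obtain ⟨h1, h2, h3, h4⟩ := mem_chainsFrom.1 hs
    have hb := hbot F s hs
    refine Finset.mem_sigma.2 ⟨Finset.mem_powerset.2 ?_, Finset.mem_filter.2
      ⟨Finset.mem_univ _, h1.mono (Finset.coe_subset.2 (Finset.erase_subset _ _)),
        (himage _ fun hc => hb (Finset.mem_of_mem_erase hc)).symm⟩⟩
    simp only [Finset.image_subset_iff, Finset.mem_image, Finset.mem_range]
    rintro _ ⟨G, hG, rfl⟩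
    have h5 : P.faceRank G < P.faceRank ⊤ :=
      P.faceRank_strictMono (lt_top_iff_ne_top.2 (Finset.ne_of_mem_erase hG))
    have h6 : P.faceRank ⊥ < P.faceRank G := P.faceRank_strictMono
      (bot_lt_iff_ne_bot.2 fun h => hb (h ▸ Finset.mem_of_mem_erase hG))
    rw [faceRank_top] at h5
    omega
  · rintro ⟨F, s⟩ hs ⟨F', s'⟩ hs' h
    have hs : s ∈ P.chainsFrom F.1 := (Finset.mem_sigma.1 hs).2
    have hs' : s' ∈ P.chainsFrom F'.1 := (Finset.mem_sigma.1 hs').2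
    have h1 : s.erase ⊤ = s'.erase ⊤ := congrArg (fun x => x.2) h
    obtain rfl : s = s' := by
      rw [← Finset.insert_erase (mem_chainsFrom.1 hs).2.2.1, h1,
        Finset.insert_erase (mem_chainsFrom.1 hs').2.2.1]
    obtain rfl : F = F' := Subtype.ext (eq_of_mem_chainsFrom hs hs')
    rfl
  · rintro ⟨S, t⟩ ht
    obtain ⟨hS, ht⟩ := Finset.mem_sigma.1 ht
    obtain ⟨-, h1, h2⟩ := Finset.mem_filter.1 ht
    have hS : ∀ a ∈ S, a < P.dim := fun a ha =>
      Finset.mem_range.1 (Finset.mem_powerset.1 hS ha)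
    have hrank : ∀ G ∈ t, ∃ a ∈ S, a + 1 = P.faceRank G := fun G hG => by
      have := h2 ▸ Finset.mem_image_of_mem P.faceRank hG
      exact Finset.mem_image.1 this
    -- Members of `t` have dimension below `n`, which excludes `P`.
    have htop : ⊤ ∉ t := fun hc => by
      obtain ⟨a, ha, h⟩ := hrank _ hc
      have := hS a ha
      rw [faceRank_top] at h
      omega
    obtain ⟨F, hF⟩ := exists_mem_chainsFrom (s := insert ⊤ t) (by
      rw [Finset.coe_insert]
      exact h1.insert fun b _ _ => Or.inr le_top) (Finset.mem_insert_self _ _)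
    -- Ranks in `t` have the form `a + 1`, so the empty face, of rank zero, cannot occur.
    have hFne : F.1.Nonempty := by
      rcases Finset.mem_insert.1 (mem_chainsFrom.1 hF).2.1 with rfl | h
      · exact P.nonempty
      · rw [neFace_iff_not_isBot, isBot_iff_eq_bot]
        rintro rfl
        obtain ⟨a, -, h'⟩ := hrank _ h
        rw [faceRank_bot] at h'
        omega
    refine ⟨⟨⟨F, hFne⟩, insert ⊤ t⟩, Finset.mem_sigma.2 ⟨Finset.mem_univ _, hF⟩, ?_⟩
    simp only [Finset.erase_insert htop, h2, Finset.image_image]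
    congr 1
    exact (Finset.image_congr fun a _ => by simp).trans Finset.image_id
  · rintro ⟨F, s⟩ hs
    have hs : s ∈ P.chainsFrom F.1 := (Finset.mem_sigma.1 hs).2
    have hi := himage_insert _ s (mem_chainsFrom.1 hs).2.2.1 (himage _ fun hc =>
      hbot F s hs (Finset.mem_of_mem_erase hc))
    have hm := min'_of_image_add_one (Finset.insert_nonempty _ _) hs hi
    have hg : P.chainType s = gaps (insert P.dim
        (((s.erase ⊤).image P.faceRank).image (· - 1))) := by
      rw [chainType, ← hi, gaps_image_add]
    have hF := P.dim_eq_faceRank F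
    -- Corresponding terms agree: the minimum of the dimensions is `dim F`, and the gaps of
    -- dimensions equal the gaps of ranks.
    exact congrArg₂ (fun n ω => Polynomial.monomial n (Qsym.monomial (List.reverse ω)))
      (Nat.succ_injective (hF.trans hm.symm)) hg

end PolytopeRing

end PolyHopf

theorem mainTheorem11 :
    (∀ P : NePolytope, PolytopeRing.coaction (PolytopeRing.of P) =
      ∑ F : NeFace P.carrier, PolytopeRing.of (P.face F) ⊗ₜ[ℤ] RP.of (P.facePolytope F)) ∧
    IsRightHopfComodule ℤ RP PolytopeRing PolytopeRing.coaction ∧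
    (∀ n, ∀ x ∈ PolytopeRing.grading n, PolytopeRing.coaction x ∈ tensorGrading n) ∧
    ehrenborg.lTensor PolytopeRing ∘ₗ PolytopeRing.coaction = PolytopeRing.coactionL ∧
    ∀ x : PolytopeRing, ehrenborgStarPoly (PolytopeRing.lAlpha x) = PolytopeRing.fPolynomial x := by
  exact ⟨PolytopeRing.coaction_of, PolytopeRing.isRightHopfComodule_coaction,
    PolytopeRing.coaction_mem_tensorGrading, PolytopeRing.lTensor_ehrenborg_coaction,
    PolytopeRing.ehrenborgStarPoly_lAlpha⟩
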